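/- **Theorem (One-block estimate).** *Setting.* Let $\mathfrak K:\mathbb R\to[0,\infty)$ be even, not a.e. zero, in $W^{1,1}(\mathbb R)\cap W^{1,\infty}(\mathbb R)$ (continuous representative), with $\int u^2\mathfrak K(u)\,du<\infty$. For $N\ge1$ and $\gamma\in(0,\tfrac14)$ let $\Lambda_N=\mathbb Z/(2N+1)\mathbb Z\cong\{-N,\dots,N\}$ and let $\kappa_\gamma(z)=\gamma\,\mathfrak K(\gamma z)$, multiplied by a constant (depending on $N,\gamma$) so that $\sum_{|z|\le N}\kappa_\gamma(z)=1$. For $\beta\in\mathbb R$ and $\sigma\in\{-1,1\}^{\Lambda_N}$ let $$H_\gamma(\sigma)=-\tfrac12\sum_{i,j\in\Lambda_N}\kappa_\gamma(i-j)\sigma_i\sigma_j,\qquad c_i(\sigma)=\frac1{1+\exp\big(\beta(H_\gamma(\sigma^{i,i+1})-H_\gamma(\sigma))\big)},$$ where $i-j$ is represented in $\{-N,\dots,N\}$ and $\sigma^{i,i+1}$ is $\sigma$ with the spins at $i$ and $i+1$ exchanged. Let $\mu_{N,\gamma,\beta}$ be the canonical Gibbs measure, proportional to $e^{-\beta H_\gamma}$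 on the sector $\{\sigma:\sum_i\sigma_i=M\}$, where $M=M(\gamma,N)$ is arbitrary. Let $\sigma(t)$, $t\ge0$, be the Ising–Kac–Kawasaki dynamics on the diffusive time scale, i.e. the Markov chain with generator $$N^2(\mathscr L^N_\gamma f)(\sigma)=N^2\sum_{i\in\Lambda_N}c_i(\sigma)\big(f(\sigma^{i,i+1})-f(\sigma)\big),$$ started from a law $f_{N,0}\,\mu_{N,\gamma,\beta}$ (which may depend on $\gamma$) whose relative entropy satisfies $H_N(f_{N,0}\mid\mu_{N,\gamma,\beta})\le C_HN$ for all $N\ge1$ and $\gamma\in(0,\frac14)$, with $C_H$ independent of $N$ and $\gamma$. Write $\mathbb E_{f_{N,0}}$ for the corresponding expectation. Let $\Psi:\{-1,1\}^{\mathbb Z}\to\mathbb R$ depend only on the coordinates in $\{-r,\dots,r\}$ for some $r\in\mathbb N$, and let $\tau_x\Psi(\sigma)=\Psi((\sigma_{x+y})_{y\in\mathbb Z})$. For $\ell\ge r$ let $\Lambda_\ell=\{-\ell,\dots,\ell\}$, $m_x^\ell(\sigma)=\frac1{2\ell+1}\sum_{|y|\le\ell}\sigma_{x+y}$, and let $\Phi^\gamma_{\Psi,\ell}(m)$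 be the expectation of $\Psi$ under the block canonical Gibbs measure on $\{\eta\in\{-1,1\}^{\Lambda_\ell}:\frac1{2\ell+1}\sum_u\eta_u=m\}$, whose weights are proportional to $\exp\big(\frac\beta2\sum_{u,v\in\Lambda_\ell}\kappa_\gamma(u-v)\eta_u\eta_v\big)$. Let $T>0$ and let $J:\mathbb R\to\mathbb R$ be smooth (in particular, $J$ may be the periodic lift of a function in $C^\infty(\mathbb T)$). Put $$E(N,\gamma,\ell)=\mathbb E_{f_{N,0}}\left|\int_0^T\frac1N\sum_{x=-N}^{N}J\Big(\frac xN\Big)\Big(\tau_x\Psi(\sigma(t))-\Phi^\gamma_{\Psi,\ell}(m^\ell_x(\sigma(t)))\Big)dt\right|.$$ *Claim.* 1. $\displaystyle\lim_{\ell\to\infty}\ \limsup_{\gamma\downarrow0}\ \limsup_{N\to\infty}E(N,\gamma,\ell)=0.$ 2. If $\ell=\ell(\gamma)\in\mathbb N$ satisfies $\ell(\gamma)\to\infty$ and $\gamma\,\ell(\gamma)\to0$ as $\gamma\downarrow0$, then $\displaystyle\lim_{\gamma\downarrow0}\ \limsup_{N\to\infty}E(N,\gamma,\ell(\gamma))=0.$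 -/

import Mathlib

open Filter Topology MeasureTheory
open scoped ENNReal ContDiff

noncomputable section

/-- Admissible profiles of a Kac kernel: nonnegative, even, in `W^{1,1} ∩ W^{1,∞}` (the continuous
representative: a Lipschitz function which is integrable together with its a.e. derivative; it is
then automatically bounded), with finite second moment, and not almost everywhere zero. -/
structure IsKacProfile (K : ℝ → ℝ) : Prop where
  nonneg : ∀ u, 0 ≤ K u
  even : ∀ u, K (-u) = K u
  lipschitz : ∃ C, LipschitzWith C K
  integrable : Integrable K
  integrable_deriv : Integrable (deriv K)
  integrable_sq_mul : Integrable (fun u => u ^ 2 * K u)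
  integral_pos : 0 < ∫ u, K u

/-- The Kac kernel `κ_γ(z) = γ K(γ z)`, normalized so that `∑_{|z| ≤ N} κ_γ(z) = 1`. -/
def kacKernel (K : ℝ → ℝ) (γ : ℝ) (N : ℕ) (z : ℤ) : ℝ :=
  γ * K (γ * z) / ∑ w ∈ Finset.Icc (-(N : ℤ)) N, γ * K (γ * w)

instance : DiscreteMeasurableSpace ℤˣ where
  forall_measurableSet s :=
    ⟨Units.val '' s, trivial, Set.preimage_image_eq s Units.val_injective⟩

/-- Spin configurations on the discrete circle `Λ_N = ℤ / (2N+1)ℤ`; the spins are the elements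
`1, -1` of `ℤˣ`. -/
abbrev Config (N : ℕ) : Type := ZMod (2 * N + 1) → ℤˣ

/-- The real value of a spin. -/
def spin (s : ℤˣ) : ℝ := ((s : ℤ) : ℝ)

/-- The Ising–Kac Hamiltonian on the circle; `valMinAbs` is the representative in `{-N, …, N}`. -/
def hamiltonian (K : ℝ → ℝ) (γ : ℝ) (N : ℕ) (σ : Config N) : ℝ :=
  -(1 / 2) * ∑ i, ∑ j, kacKernel K γ N (i - j).valMinAbs * spin (σ i) * spin (σ j)

/-- The sector of configurations with total magnetization `M`. -/
def sector (N : ℕ) (M : ℤ) : Set (Config N) := {σ | ∑ i, (σ i : ℤ) = M}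

open Classical in
/-- The Gibbs measure of the energy `H` at inverse temperature `β`, restricted to the
configurations in `S` and normalized. -/
def gibbs {C : Type*} [Fintype C] [MeasurableSpace C] (β : ℝ) (H : C → ℝ) (S : Set C) :
    Measure C :=
  ∑ σ with σ ∈ S,
    ENNReal.ofReal (Real.exp (-β * H σ) / ∑ τ with τ ∈ S, Real.exp (-β * H τ)) •
      Measure.dirac σ

/-- The configuration `σ^{i,i+1}` with the spins at `i` and `i + 1` exchanged. -/
def exchange {N : ℕ} (σ : Config N) (i : ZMod (2 * N + 1)) : Config N :=
  σ ∘ Equiv.swap i (i + 1)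

/-- The heat-bath exchange rate `c_i(σ)` on the bond `(i, i+1)`. -/
def rate (K : ℝ → ℝ) (γ β : ℝ) {N : ℕ} (σ : Config N) (i : ZMod (2 * N + 1)) : ℝ :=
  1 / (1 + Real.exp (β * (hamiltonian K γ N (exchange σ i) - hamiltonian K γ N σ)))

/-- The matrix of the Kawasaki generator
`(L f)(σ) = ∑ i, c_i(σ) (f(σ^{i,i+1}) - f(σ)) = ∑ τ, L σ τ * f τ`. -/
def generator (K : ℝ → ℝ) (γ β : ℝ) (N : ℕ) : Matrix (Config N) (Config N) ℝ :=
  fun σ τ => ∑ i, rate K γ β σ i *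
    ((if exchange σ i = τ then 1 else 0) - (if σ = τ then 1 else 0))

/-- `X` is a continuous-time Markov chain on the finite set `S`, in the times `t ≥ 0`, with
generator matrix `Q` and initial law `ν`: its paths are right-continuous step functions with left
limits, and its finite-dimensional distributions are given by the semigroup `exp (t Q)`. -/
structure IsMarkovChain {S Ω : Type*} [Fintype S] [DecidableEq S] [MeasurableSpace S]
    [MeasurableSpace Ω] (Q : Matrix S S ℝ) (ν : Measure S) (P : Measure Ω) (X : ℝ → Ω → S) :
    Prop where
  isProbabilityMeasure : IsProbabilityMeasure P
  measurable : ∀ t, 0 ≤ t → Measurable (X t)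
  right_continuous : ∀ w t, 0 ≤ t → ∀ᶠ s in 𝓝[>] t, X s w = X t w
  left_limit : ∀ w t, 0 < t → ∃ a, ∀ᶠ s in 𝓝[<] t, X s w = a
  finite_dimensional : ∀ (n : ℕ) (t : ℕ → ℝ) (a : ℕ → S), t 0 = 0 → Monotone t →
    P.real {w | ∀ i ≤ n, X (t i) w = a i} =
      ν.real {a 0} *
        ∏ i ∈ Finset.range n, NormedSpace.exp ((t (i + 1) - t i) • Q) (a i) (a (i + 1))

/-- Spin configurations on the block `Λ_ℓ = {-ℓ, …, ℓ}`. -/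
abbrev BlockConfig (ℓ : ℕ) : Type := Finset.Icc (-(ℓ : ℤ)) (ℓ : ℤ) → ℤˣ

/-- The block Hamiltonian (free boundary conditions). -/
def blockHamiltonian (K : ℝ → ℝ) (γ : ℝ) (N ℓ : ℕ) (η : BlockConfig ℓ) : ℝ :=
  -(1 / 2) * ∑ u : Finset.Icc (-(ℓ : ℤ)) (ℓ : ℤ), ∑ v : Finset.Icc (-(ℓ : ℤ)) (ℓ : ℤ),
    kacKernel K γ N ((u : ℤ) - (v : ℤ)) * spin (η u) * spin (η v)

/-- The block configurations with mean magnetization `m`. -/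
def blockSector (ℓ : ℕ) (m : ℝ) : Set (BlockConfig ℓ) :=
  {η | (∑ u, spin (η u)) / (2 * ℓ + 1) = m}

/-- A block configuration as a configuration on `ℤ`; the values outside the block are
irrelevant for observables supported in the block. -/
def blockExtend {ℓ : ℕ} (η : BlockConfig ℓ) (y : ℤ) : ℤˣ :=
  if h : y ∈ Finset.Icc (-(ℓ : ℤ)) (ℓ : ℤ) then η ⟨y, h⟩ else 1

/-- `Φ_{Ψ,ℓ}^γ(m)`: the expectation of `Ψ` under the canonical block Gibbs measure with mean
magnetization `m`. -/
def canonicalMean (K : ℝ → ℝ) (γ β : ℝ) (N : ℕ) (Ψ : (ℤ → ℤˣ) → ℝ) (ℓ : ℕ) (m : ℝ) : ℝ :=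
  ∫ η, Ψ (blockExtend η) ∂(gibbs β (blockHamiltonian K γ N ℓ) (blockSector ℓ m))

/-- The block average `m_x^ℓ(σ)`. -/
def blockAverage {N : ℕ} (ℓ : ℕ) (x : ZMod (2 * N + 1)) (σ : Config N) : ℝ :=
  (∑ y ∈ Finset.Icc (-(ℓ : ℤ)) (ℓ : ℤ), spin (σ (x + (y : ZMod (2 * N + 1))))) / (2 * ℓ + 1)

/-- The translate `τ_x σ`, read periodically as a configuration on `ℤ`. -/
def shiftConfig {N : ℕ} (x : ZMod (2 * N + 1)) (σ : Config N) (y : ℤ) : ℤˣ :=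
  σ (x + (y : ZMod (2 * N + 1)))

/-- The spatial average `N⁻¹ ∑_x J(x/N) (τ_x Ψ(σ) - Φ_{Ψ,ℓ}^γ(m_x^ℓ(σ)))`. -/
def oneBlockAverage (K : ℝ → ℝ) (γ β : ℝ) (N : ℕ) (Ψ : (ℤ → ℤˣ) → ℝ) (J : ℝ → ℝ) (ℓ : ℕ)
    (σ : Config N) : ℝ :=
  1 / (N : ℝ) * ∑ x : ZMod (2 * N + 1), J ((x.valMinAbs : ℝ) / N) *
    (Ψ (shiftConfig x σ) - canonicalMean K γ β N Ψ ℓ (blockAverage ℓ x σ))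

/-- The expectation of the absolute value of the time integral over `[0, T]` of the spatial
average along the process `X`. -/
def oneBlockError {Ω : Type*} [MeasurableSpace Ω] (K : ℝ → ℝ) (γ β : ℝ) (N : ℕ)
    (Ψ : (ℤ → ℤˣ) → ℝ) (J : ℝ → ℝ) (T : ℝ) (P : Measure Ω) (X : ℝ → Ω → Config N) (ℓ : ℕ) :
    ℝ≥0∞ :=
  ∫⁻ w, ENNReal.ofReal |∫ t in (0 : ℝ)..T, oneBlockAverage K γ β N Ψ J ℓ (X t w)| ∂P

end

/-!
The proof compares everything with exchangeable measures. Since the Kac kernel has size and total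
variation of order `γ`, an exchange of two neighbouring spins changes the energy by `O(γ)`, so every
rate is `1/2 + O(γ)`, and a block of `2 ℓ + 1` sites with `γ ℓ` small should be almost exchangeable.

*Dynamics.* The relative entropy of the law `p t` with respect to the Gibbs measure on all
configurations is at most of order `N`, because there are `2 ^ (2 N + 1)` configurations of energy
`O(N)`. On the time scale `N ^ 2` the entropy production therefore forces
`∑ σ, |p t (σ^{z,z+1}) - p t σ|` to be `O(γ + N⁻¹)` on average over the bonds `z` and over time
(`integral_sum_abs_sub_le`, `integral_sum_swapDefect_le`). An exchange of two sites at distance at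
most `2 ℓ` is a composition of neighbour exchanges, and costs `O(γ ℓ)` (`swapDefect_path_le`).

*Blocks.* Expand the observable into products of spins (`exists_eq_sum_prod_spin`). For a product of
`k` spins, the average over translates inside a block is close to the `k`-th power of the block
magnetization `m`: spins are replaced by `m` one at a time, and in the second moment of each
replacement a single exchange of the replaced spin with a generic site of the block produces the
opposite sign (`sum_mul_sq_average_le`, `sum_mul_abs_average_sub_pow_le`). The same argument applies
to the canonical block Gibbs measure, where `m` is deterministic, since an exchange inside the block
changes its energy by `O(γ ℓ)` (`abs_canonicalMean_sub_le`). So block averages of the observable and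
the canonical mean are both close to the same polynomial in `m`, with errors controlled by
`u = γ ℓ + ℓ⁻¹`; no equivalence of ensembles beyond this is needed.

*Conclusion.* Smoothness of the test function allows to replace the observable by its average over
translates, at a cost `O(ℓ / N)`. The limit superior as `N → ∞` of the error is then at most a
function of `u` which is continuous and vanishes at `0` (`exists_limsup_oneBlockError_le`), and both
claims follow.
-/

/-! ### Near exchangeability -/

theorem abs_spin (s : ℤˣ) : |spin s| = 1 := by
  rcases Int.units_eq_one_or s with h | h <;> simp [spin, h]

theorem abs_prod_spin {ι : Type*} (B : Finset ι) (f : ι → ℤˣ) : |∏ i ∈ B, spin (f i)| = 1 := by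
  simp [Finset.abs_prod, abs_spin]

/-- The average of the spins at the sites `e w`. -/
noncomputable def siteMean {V W : Type*} [Fintype W] (e : W → V) (σ : V → ℤˣ) : ℝ :=
  (∑ w, spin (σ (e w))) / Fintype.card W

theorem abs_siteMean_le {V W : Type*} [Fintype W] (e : W → V) (σ : V → ℤˣ) :
    |siteMean e σ| ≤ 1 := by
  rw [siteMean, abs_div, Nat.abs_cast]
  apply div_le_one_of_le₀ _ (Nat.cast_nonneg _)
  refine (Finset.abs_sum_le_sum_abs _ _).trans ?_
  simp [abs_spin]

/-- The `ℓ¹` distance between the weight `ρ` and its image under the exchange of the sites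
`a` and `b`. -/
noncomputable def swapDefect {V : Type*} [Fintype V] [DecidableEq V] (ρ : (V → ℤˣ) → ℝ)
    (a b : V) : ℝ :=
  ∑ σ : V → ℤˣ, |ρ (σ ∘ Equiv.swap a b) - ρ σ|

theorem comp_swap_comp_swap {V : Type*} [DecidableEq V] (σ : V → ℤˣ) (a b : V) :
    (σ ∘ Equiv.swap a b) ∘ Equiv.swap a b = σ := by
  ext v; simp

theorem siteMean_comp_swap {V W : Type*} [DecidableEq V] [Fintype W]
    [DecidableEq W] {e : W → V} (he : Function.Injective e) (u w : W) (σ : V → ℤˣ) :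
    siteMean e (σ ∘ Equiv.swap (e u) (e w)) = siteMean e σ := by
  unfold siteMean
  congr 1
  refine Fintype.sum_equiv (Equiv.swap u w) _ _ fun v => ?_
  rw [Function.comp_apply, he.map_swap]

theorem spin_comp_swap_of_notMem {V W : Type*} [DecidableEq V] {e : W → V}
    (he : Function.Injective e) {A : Finset W} {u w v : W}
    (hu : u ∉ A) (hw : w ∉ A) (hv : v ∈ A) (σ : V → ℤˣ) :
    spin ((σ ∘ Equiv.swap (e u) (e w)) (e v)) = spin (σ (e v)) := by
  rw [Function.comp_apply, Equiv.swap_apply_of_ne_of_ne]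
  · exact he.ne fun h => hu (h ▸ hv)
  · exact he.ne fun h => hw (h ▸ hv)

section Exchange

variable {V W : Type*} [Fintype V] [DecidableEq V] [Fintype W] [DecidableEq W]

theorem sum_comp_perm (s : Equiv.Perm V) (F : (V → ℤˣ) → ℝ) :
    ∑ σ : V → ℤˣ, F (σ ∘ s) = ∑ σ, F σ :=
  Fintype.sum_equiv (s.symm.arrowCongr (Equiv.refl _)) _ _ fun σ => by
    congr 1

/-- An observable which is odd under the exchange of `a` and `b` has a small mean under a weight
which is nearly invariant under that exchange. -/
theorem abs_sum_mul_spin_sub_le (ρ : (V → ℤˣ) → ℝ) (a b : V) (h : (V → ℤˣ) → ℝ)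
    (h1 : ∀ σ, |h σ| ≤ 1) (hinv : ∀ σ, h (σ ∘ Equiv.swap a b) = h σ) :
    |∑ σ, ρ σ * (h σ * (spin (σ a) - spin (σ b)))| ≤ swapDefect ρ a b := by
  have key : 2 * ∑ σ, ρ σ * (h σ * (spin (σ a) - spin (σ b))) =
      ∑ σ, (ρ σ - ρ (σ ∘ Equiv.swap a b)) * (h σ * (spin (σ a) - spin (σ b))) := by
    have := sum_comp_perm (Equiv.swap a b)
      (fun σ => ρ (σ ∘ Equiv.swap a b) * (h σ * (spin (σ a) - spin (σ b))))
    simp only [comp_swap_comp_swap, hinv, Function.comp_apply, Equiv.swap_apply_left,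
      Equiv.swap_apply_right] at this
    simp only [sub_mul, Finset.sum_sub_distrib, ← this]
    rw [two_mul, sub_eq_add_neg, ← Finset.sum_neg_distrib]
    congr 1
    exact Finset.sum_congr rfl fun σ _ => by ring
  have h2 : |2 * ∑ σ, ρ σ * (h σ * (spin (σ a) - spin (σ b)))| ≤ 2 * swapDefect ρ a b := by
    rw [key, swapDefect, Finset.mul_sum]
    refine (Finset.abs_sum_le_sum_abs _ _).trans (Finset.sum_le_sum fun σ _ => ?_)
    rw [abs_mul, abs_mul, abs_sub_comm, mul_comm 2]
    have h3 : |spin (σ a) - spin (σ b)| ≤ 2 := by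
      refine (abs_sub _ _).trans ?_
      rw [abs_spin, abs_spin]; norm_num
    have h4 : |h σ| * |spin (σ a) - spin (σ b)| ≤ 1 * 2 :=
      mul_le_mul (h1 σ) h3 (abs_nonneg _) zero_le_one
    rw [one_mul] at h4
    exact mul_le_mul_of_nonneg_left h4 (abs_nonneg _)
  rw [abs_mul, abs_two] at h2
  linarith

variable {e : W → V} {ρ : (V → ℤˣ) → ℝ} {D : ℝ}

/-- Replacing one spin of the block by the block average costs little, against any observable
which is insensitive to exchanges inside the block away from a small set `A`. -/
theorem abs_sum_mul_spin_sub_siteMean_le (hρ : ∀ σ, 0 ≤ ρ σ) (hρ1 : ∑ σ, ρ σ ≤ 1)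
    (hD : ∀ u w, swapDefect ρ (e u) (e w) ≤ D) (h : (V → ℤˣ) → ℝ) (h1 : ∀ σ, |h σ| ≤ 1)
    (A : Finset W)
    (hinv : ∀ u w, u ∉ A → w ∉ A → ∀ σ, h (σ ∘ Equiv.swap (e u) (e w)) = h σ)
    (u : W) (hu : u ∉ A) :
    |∑ σ, ρ σ * (h σ * (spin (σ (e u)) - siteMean e σ))| ≤
      D + 2 * A.card / Fintype.card W := by
  have hn : (0 : ℝ) < Fintype.card W := by
    exact_mod_cast Fintype.card_pos_iff.2 ⟨u⟩
  have hD0 : 0 ≤ D := (Finset.sum_nonneg fun _ _ => abs_nonneg _).trans (hD u u)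
  have key : (Fintype.card W : ℝ) * ∑ σ, ρ σ * (h σ * (spin (σ (e u)) - siteMean e σ)) =
      ∑ w : W, ∑ σ, ρ σ * (h σ * (spin (σ (e u)) - spin (σ (e w)))) := by
    rw [Finset.sum_comm, Finset.mul_sum]
    refine Finset.sum_congr rfl fun σ _ => ?_
    rw [← Finset.mul_sum, ← Finset.mul_sum, Finset.sum_sub_distrib, siteMean]
    simp only [Finset.sum_const, Finset.card_univ, nsmul_eq_mul]
    field_simp
  have hterm : ∀ w : W, |∑ σ, ρ σ * (h σ * (spin (σ (e u)) - spin (σ (e w))))| ≤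
      D + (if w ∈ A then 2 else 0) := by
    intro w
    split_ifs with hw
    · have : |∑ σ, ρ σ * (h σ * (spin (σ (e u)) - spin (σ (e w))))| ≤ ∑ σ, ρ σ * 2 := by
        refine (Finset.abs_sum_le_sum_abs _ _).trans (Finset.sum_le_sum fun σ _ => ?_)
        rw [abs_mul, abs_mul, abs_of_nonneg (hρ σ)]
        refine mul_le_mul_of_nonneg_left ?_ (hρ σ)
        have h3 : |spin (σ (e u)) - spin (σ (e w))| ≤ 2 := by
          refine (abs_sub _ _).trans ?_
          rw [abs_spin, abs_spin]; norm_num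
        calc |h σ| * |spin (σ (e u)) - spin (σ (e w))| ≤ 1 * 2 :=
              mul_le_mul (h1 σ) h3 (abs_nonneg _) zero_le_one
          _ = 2 := one_mul _
      rw [← Finset.sum_mul] at this
      linarith
    · rw [add_zero]
      exact (abs_sum_mul_spin_sub_le ρ _ _ h h1 (hinv u w hu hw)).trans (hD u w)
  have h2 : (Fintype.card W : ℝ) * |∑ σ, ρ σ * (h σ * (spin (σ (e u)) - siteMean e σ))| ≤
      Fintype.card W * D + 2 * A.card := by
    rw [← abs_of_pos hn, ← abs_mul, abs_of_pos hn, key]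
    refine (Finset.abs_sum_le_sum_abs _ _).trans
      ((Finset.sum_le_sum fun w _ => hterm w).trans (le_of_eq ?_))
    simp [Finset.sum_add_distrib, mul_comm]
  rw [← mul_le_mul_iff_right₀ hn, mul_add, mul_div_cancel₀ _ hn.ne']
  exact h2

/-- Under a nearly exchangeable weight with deterministic block average `m`, the mean of a product
of `k` distinct spins is close to `m ^ k`. -/
theorem abs_sum_mul_prod_spin_sub_pow_le (he : Function.Injective e) (hρ : ∀ σ, 0 ≤ ρ σ)
    (hρ1 : ∑ σ, ρ σ = 1) (hD : ∀ u w, swapDefect ρ (e u) (e w) ≤ D) (m : ℝ)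
    (hm : ∀ σ, ρ σ ≠ 0 → siteMean e σ = m) (B : Finset W) :
    |∑ σ, ρ σ * ∏ v ∈ B, spin (σ (e v)) - m ^ B.card| ≤
      B.card * (D + 2 * B.card / Fintype.card W) := by
  have hm1 : |m| ≤ 1 := by
    obtain ⟨σ, -, hσ⟩ := Finset.exists_ne_zero_of_sum_ne_zero (hρ1.trans_ne one_ne_zero)
    rw [← hm σ hσ]
    exact abs_siteMean_le e σ
  induction B using Finset.induction_on with
  | empty => simp [hρ1]
  | insert a B ha ih =>
    have h1 := abs_sum_mul_spin_sub_siteMean_le hρ hρ1.le hD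
      (fun σ => ∏ v ∈ B, spin (σ (e v))) (fun σ => (abs_prod_spin _ _).le) B
      (fun u w hu hw σ => Finset.prod_congr rfl fun v hv =>
        spin_comp_swap_of_notMem he hu hw hv σ) a ha
    have hsplit : ∑ σ, ρ σ * ∏ v ∈ insert a B, spin (σ (e v)) - m ^ (insert a B).card =
        ∑ σ, ρ σ * ((∏ v ∈ B, spin (σ (e v))) * (spin (σ (e a)) - siteMean e σ)) +
          m * (∑ σ, ρ σ * ∏ v ∈ B, spin (σ (e v)) - m ^ B.card) := by
      rw [Finset.card_insert_of_notMem ha, pow_succ', mul_sub, ← add_sub_assoc, sub_left_inj,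
        Finset.mul_sum, ← Finset.sum_add_distrib]
      refine Finset.sum_congr rfl fun σ _ => ?_
      rw [Finset.prod_insert ha]
      by_cases h : ρ σ = 0
      · simp [h]
      · rw [hm σ h]; ring
    rw [hsplit, Finset.card_insert_of_notMem ha]
    refine (abs_add_le _ _).trans ?_
    rw [abs_mul]
    have h2 : |m| * |∑ σ, ρ σ * ∏ v ∈ B, spin (σ (e v)) - m ^ B.card| ≤
        1 * (B.card * (D + 2 * B.card / Fintype.card W)) :=
      mul_le_mul hm1 ih (abs_nonneg _) zero_le_one
    have h3 : (2 : ℝ) * B.card / Fintype.card W ≤ 2 * (B.card + 1 : ℕ) / Fintype.card W := by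
      gcongr; simp
    push_cast at h3 ⊢
    have h4 : (B.card : ℝ) * (D + 2 * B.card / Fintype.card W) ≤
        B.card * (D + 2 * (B.card + 1) / Fintype.card W) := by gcongr
    linarith

end Exchange

/-! ### Spatial averages of products of spins -/

section Exchange

variable {V W : Type*} [Fintype V] [DecidableEq V] [Fintype W] [DecidableEq W]
variable {e : W → V} {ρ : (V → ℤˣ) → ℝ} {D : ℝ} {ι Y : Type*} [DecidableEq ι] [Fintype Y]
  {s : ι → Y → W}

/-- Second moment of the spatial average over `y` of a product of spins times the fluctuation of
one more spin around the block average. The product of the terms at `y` and `y'` is handled by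
exchanging the last spin at `y` with a generic site of the block. -/
theorem sum_mul_sq_average_le (he : Function.Injective e) (hρ : ∀ σ, 0 ≤ ρ σ)
    (hρ1 : ∑ σ, ρ σ ≤ 1) (hD : ∀ u w, swapDefect ρ (e u) (e w) ≤ D)
    (hs : ∀ i, Function.Injective (s i)) (hne : ∀ i j, i ≠ j → ∀ y, s i y ≠ s j y)
    [Nonempty Y] (B : Finset ι) (a : ι) (ha : a ∉ B) :
    ∑ σ, ρ σ * ((∑ y, (∏ i ∈ B, spin (σ (e (s i y)))) *
      (spin (σ (e (s a y))) - siteMean e σ)) / Fintype.card Y) ^ 2 ≤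
      2 * D + 12 * (B.card + 1) / Fintype.card Y := by
  have hq : (0 : ℝ) < Fintype.card Y := by exact_mod_cast Fintype.card_pos
  have hqn : (Fintype.card Y : ℝ) ≤ Fintype.card W := by
    exact_mod_cast Fintype.card_le_of_injective _ (hs a)
  have hn : (0 : ℝ) < Fintype.card W := hq.trans_le hqn
  have hD0 : 0 ≤ D := by
    obtain ⟨y⟩ := ‹Nonempty Y›
    exact (Finset.sum_nonneg fun _ _ => abs_nonneg _).trans (hD (s a y) (s a y))
  set G : Y → (V → ℤˣ) → ℝ := fun y σ => ∏ i ∈ B, spin (σ (e (s i y))) with hG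
  set F : Y → (V → ℤˣ) → ℝ := fun y σ => spin (σ (e (s a y))) - siteMean e σ with hF
  have hF2 : ∀ y σ, |F y σ| ≤ 2 := fun y σ => by
    refine (abs_sub _ _).trans ?_
    have := abs_siteMean_le e σ
    rw [abs_spin]; linarith
  have hG1 : ∀ y σ, |G y σ| = 1 := fun y σ => abs_prod_spin _ _
  have hexp : ∑ σ, ρ σ * ((∑ y, G y σ * F y σ) / Fintype.card Y) ^ 2 =
      (∑ y, ∑ y', 2 * ∑ σ, ρ σ * ((G y σ * G y' σ * F y' σ / 2) * F y σ)) /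
        (Fintype.card Y : ℝ) ^ 2 := by
    have : ∀ y, ∑ y', 2 * ∑ σ, ρ σ * ((G y σ * G y' σ * F y' σ / 2) * F y σ) =
        ∑ σ, ρ σ * ((G y σ * F y σ) * ∑ y', G y' σ * F y' σ) := fun y => by
      simp only [Finset.mul_sum]
      rw [Finset.sum_comm]
      exact Finset.sum_congr rfl fun σ _ => Finset.sum_congr rfl fun y' _ => by ring
    simp only [this]
    rw [Finset.sum_comm, Finset.sum_div]
    refine Finset.sum_congr rfl fun σ _ => ?_
    rw [← Finset.mul_sum, ← Finset.sum_mul]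
    ring
  have hterm : ∀ y y', 2 * ∑ σ, ρ σ * ((G y σ * G y' σ * F y' σ / 2) * F y σ) ≤
      2 * (D + 2 * (2 * B.card + 1) / Fintype.card W) +
        4 * ∑ i ∈ insert a B, if s i y' = s a y then 1 else 0 := by
    intro y y'
    have hh1 : ∀ σ, |G y σ * G y' σ * F y' σ / 2| ≤ 1 := fun σ => by
      rw [abs_div, abs_mul, abs_mul, hG1, hG1, abs_two]
      linarith [hF2 y' σ]
    have hsum0 : (0 : ℝ) ≤ ∑ i ∈ insert a B, if s i y' = s a y then (1 : ℝ) else 0 :=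
      Finset.sum_nonneg fun i _ => by split_ifs <;> norm_num
    -- the sites, other than those entering through the block average, on which the factor
    -- multiplying `F y` depends
    set A : Finset W := insert (s a y') (B.image (fun i => s i y) ∪ B.image (fun i => s i y'))
      with hA
    have hAc : (A.card : ℝ) ≤ 2 * B.card + 1 := by
      have h1 : A.card ≤ (B.card + B.card) + 1 :=
        (Finset.card_insert_le _ _).trans (Nat.add_le_add_right
          ((Finset.card_union_le _ _).trans
            (Nat.add_le_add Finset.card_image_le Finset.card_image_le)) 1)
      have : (A.card : ℝ) ≤ ((B.card + B.card) + 1 : ℕ) := by exact_mod_cast h1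
      push_cast at this
      linarith
    by_cases hmem : s a y ∈ A
    · have h1 : (1 : ℝ) ≤ ∑ i ∈ insert a B, if s i y' = s a y then (1 : ℝ) else 0 := by
        obtain ⟨i, hi, hiy⟩ : ∃ i ∈ insert a B, s i y' = s a y := by
          rw [hA, Finset.mem_insert, Finset.mem_union, Finset.mem_image, Finset.mem_image] at hmem
          rcases hmem with h | ⟨i, hi, h⟩ | ⟨i, hi, h⟩
          · exact ⟨a, Finset.mem_insert_self _ _, h.symm⟩
          · exact absurd h (hne i a (fun h => ha (h ▸ hi)) y)
          · exact ⟨i, Finset.mem_insert_of_mem hi, h⟩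
        refine le_trans ?_ (Finset.single_le_sum
          (f := fun i => if s i y' = s a y then (1 : ℝ) else 0) (fun i _ => by split_ifs <;> norm_num) hi)
        simp [hiy]
      have h2 : ∑ σ, ρ σ * ((G y σ * G y' σ * F y' σ / 2) * F y σ) ≤ ∑ σ, ρ σ * 2 := by
        refine Finset.sum_le_sum fun σ _ => mul_le_mul_of_nonneg_left ?_ (hρ σ)
        refine (le_abs_self _).trans ?_
        rw [abs_mul]
        calc _ ≤ 1 * 2 := mul_le_mul (hh1 σ) (hF2 y σ) (abs_nonneg _) zero_le_one
          _ = 2 := one_mul _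
      rw [← Finset.sum_mul] at h2
      have h3 : 0 ≤ 2 * (2 * (B.card : ℝ) + 1) / Fintype.card W := by positivity
      linarith
    · have := abs_sum_mul_spin_sub_siteMean_le hρ hρ1 hD
        (fun σ => G y σ * G y' σ * F y' σ / 2) hh1 A
        (fun u w hu hw σ => by
          have e1 : G y (σ ∘ Equiv.swap (e u) (e w)) = G y σ :=
            Finset.prod_congr rfl fun i hi => spin_comp_swap_of_notMem he hu hw
              (by simp only [hA, Finset.mem_insert, Finset.mem_union, Finset.mem_image]
                  exact Or.inr (Or.inl ⟨i, hi, rfl⟩)) σ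
          have e2 : G y' (σ ∘ Equiv.swap (e u) (e w)) = G y' σ :=
            Finset.prod_congr rfl fun i hi => spin_comp_swap_of_notMem he hu hw
              (by simp only [hA, Finset.mem_insert, Finset.mem_union, Finset.mem_image]
                  exact Or.inr (Or.inr ⟨i, hi, rfl⟩)) σ
          have e3 : F y' (σ ∘ Equiv.swap (e u) (e w)) = F y' σ := by
            simp only [hF]
            rw [siteMean_comp_swap he, spin_comp_swap_of_notMem he hu hw
              (Finset.mem_insert_self _ _)]
          simp only [e1, e2, e3]) (s a y) hmem
      have h2 := (le_abs_self _).trans this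
      have h3 : 2 * (A.card : ℝ) / Fintype.card W ≤ 2 * (2 * B.card + 1) / Fintype.card W := by
        gcongr
      simp only [hF] at h2 ⊢
      linarith
  -- injectivity leaves at most one `y'` for each `y` and `i` in the exceptional case
  have hcount : ∑ y : Y, ∑ y' : Y, ∑ i ∈ insert a B, (if s i y' = s a y then (1 : ℝ) else 0) ≤
      Fintype.card Y * (B.card + 1) := by
    have : ∀ y : Y, ∑ y' : Y, ∑ i ∈ insert a B, (if s i y' = s a y then (1 : ℝ) else 0) ≤
        B.card + 1 := fun y => by
      rw [Finset.sum_comm]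
      calc _ ≤ ∑ i ∈ insert a B, (1 : ℝ) := Finset.sum_le_sum fun i _ => by
            rw [Finset.sum_boole]
            norm_cast
            exact Finset.card_le_one.2 fun y1 h1 y2 h2 => hs i (by
              rw [(Finset.mem_filter.1 h1).2, (Finset.mem_filter.1 h2).2])
        _ = B.card + 1 := by simp [Finset.card_insert_of_notMem ha]
    refine (Finset.sum_le_sum fun y _ => this y).trans (le_of_eq ?_)
    simp [mul_add]
  change ∑ σ, ρ σ * ((∑ y, G y σ * F y σ) / Fintype.card Y) ^ 2 ≤ _
  rw [hexp, div_le_iff₀ (by positivity)]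
  refine (Finset.sum_le_sum fun y _ => Finset.sum_le_sum fun y' _ => hterm y y').trans ?_
  simp only [Finset.sum_add_distrib, ← Finset.mul_sum]
  simp only [Finset.sum_const, Finset.card_univ, nsmul_eq_mul]
  have h5 : 2 * (2 * (B.card : ℝ) + 1) / Fintype.card W ≤
      2 * (2 * B.card + 1) / Fintype.card Y := by gcongr
  have h6 : (2 * D + 12 * (B.card + 1) / Fintype.card Y) * (Fintype.card Y : ℝ) ^ 2 =
      Fintype.card Y * (Fintype.card Y * (2 * D)) + 12 * (B.card + 1) * Fintype.card Y := by
    field_simp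
  have h7 : (Fintype.card Y : ℝ) * (Fintype.card Y * (2 * (D + 2 * (2 * B.card + 1) /
      Fintype.card W))) ≤ Fintype.card Y * (Fintype.card Y * (2 * D)) +
        4 * (2 * B.card + 1) * Fintype.card Y := by
    calc _ ≤ (Fintype.card Y : ℝ) * (Fintype.card Y * (2 * (D + 2 * (2 * B.card + 1) /
      Fintype.card Y))) := by gcongr
      _ = _ := by field_simp; ring
  rw [h6]
  nlinarith [mul_nonneg hq.le (Nat.cast_nonneg (α := ℝ) B.card)]

/-- Under a nearly exchangeable weight, spatial averages of a product of `k` spins are close in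
mean to the `k`-th power of the block average. -/
theorem sum_mul_abs_average_sub_pow_le (he : Function.Injective e) (hρ : ∀ σ, 0 ≤ ρ σ)
    (hρ1 : ∑ σ, ρ σ ≤ 1) (hD : ∀ u w, swapDefect ρ (e u) (e w) ≤ D)
    (hs : ∀ i, Function.Injective (s i)) (hne : ∀ i j, i ≠ j → ∀ y, s i y ≠ s j y)
    [Nonempty Y] {θ : ℝ} (hθ : 0 < θ) (B : Finset ι) :
    ∑ σ, ρ σ * |(∑ y, ∏ i ∈ B, spin (σ (e (s i y)))) / Fintype.card Y - siteMean e σ ^ B.card| ≤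
      B.card * (θ + (2 * D + 12 * B.card / Fintype.card Y) / θ) := by
  have hq : (0 : ℝ) < Fintype.card Y := by exact_mod_cast Fintype.card_pos
  induction B using Finset.induction_on with
  | empty => simp [hq.ne']
  | insert a B ha ih =>
    have hsq := sum_mul_sq_average_le he hρ hρ1 hD hs hne B a ha
    set U : (V → ℤˣ) → ℝ := fun σ => (∑ y, (∏ i ∈ B, spin (σ (e (s i y)))) *
      (spin (σ (e (s a y))) - siteMean e σ)) / Fintype.card Y with hU
    set R : (V → ℤˣ) → ℝ := fun σ =>
      (∑ y, ∏ i ∈ B, spin (σ (e (s i y)))) / Fintype.card Y - siteMean e σ ^ B.card with hR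
    have hsplit : ∀ σ, (∑ y, ∏ i ∈ insert a B, spin (σ (e (s i y)))) / Fintype.card Y -
        siteMean e σ ^ (insert a B).card = U σ + siteMean e σ * R σ := fun σ => by
      simp only [Finset.prod_insert ha, Finset.card_insert_of_notMem ha, hU, hR, mul_sub,
        Finset.sum_sub_distrib, ← Finset.sum_mul]
      have : ∀ y, spin (σ (e (s a y))) * ∏ i ∈ B, spin (σ (e (s i y))) =
        (∏ i ∈ B, spin (σ (e (s i y)))) * spin (σ (e (s a y))) := fun y => mul_comm _ _
      simp only [this]
      field_simp
      ring
    -- Young's inequality turns the second moment into a first moment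
    have hUabs : ∀ x : ℝ, |x| ≤ θ + x ^ 2 / θ := fun x => by
      rw [← sub_nonneg]
      have : θ + x ^ 2 / θ - |x| = ((|x| - θ / 2) ^ 2 + 3 / 4 * θ ^ 2) / θ := by
        rw [← sq_abs x]; field_simp; ring
      rw [this]; positivity
    have h1 : ∑ σ, ρ σ * |(∑ y, ∏ i ∈ insert a B, spin (σ (e (s i y)))) / Fintype.card Y -
        siteMean e σ ^ (insert a B).card| ≤
        ∑ σ, (ρ σ * θ + ρ σ * U σ ^ 2 / θ + ρ σ * |R σ|) := by
      refine Finset.sum_le_sum fun σ _ => ?_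
      rw [hsplit, mul_div_assoc, ← mul_add, ← mul_add]
      refine mul_le_mul_of_nonneg_left ((abs_add_le _ _).trans (add_le_add (hUabs _) ?_)) (hρ σ)
      rw [abs_mul]
      exact mul_le_of_le_one_left (abs_nonneg _) (abs_siteMean_le e σ)
    refine h1.trans ?_
    rw [Finset.sum_add_distrib, Finset.sum_add_distrib, ← Finset.sum_mul, ← Finset.sum_div,
      Finset.card_insert_of_notMem ha]
    have h2 : (∑ σ, ρ σ) * θ ≤ 1 * θ := mul_le_mul_of_nonneg_right hρ1 hθ.le
    have h3 : (∑ σ, ρ σ * U σ ^ 2) / θ ≤ (2 * D + 12 * (B.card + 1) / Fintype.card Y) / θ := by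
      gcongr
    have h4 : (B.card : ℝ) * (θ + (2 * D + 12 * B.card / Fintype.card Y) / θ) ≤
        B.card * (θ + (2 * D + 12 * (B.card + 1) / Fintype.card Y) / θ) := by
      gcongr; linarith
    push_cast
    linarith

end Exchange

/-- A cylinder observable is a linear combination of products of spins. -/
theorem exists_eq_sum_prod_spin (S : Finset ℤ) (Ψ : (ℤ → ℤˣ) → ℝ) (hΨ : DependsOn Ψ (S : Set ℤ)) :
    ∃ c : Finset ℤ → ℝ, ∀ σ, Ψ σ = ∑ A ∈ S.powerset, c A * ∏ i ∈ A, spin (σ i) := by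
  induction S using Finset.induction_on generalizing Ψ with
  | empty =>
    refine ⟨fun _ => Ψ 1, fun σ => ?_⟩
    simpa using hΨ (x := σ) (y := 1) (by simp)
  | insert a S ha ih =>
    have hdep : ∀ t : ℤˣ, DependsOn (fun σ => Ψ (Function.update σ a t)) (S : Set ℤ) := by
      intro t σ τ h
      refine hΨ fun i hi => ?_
      by_cases hia : i = a
      · subst hia; simp
      · rw [Function.update_of_ne hia, Function.update_of_ne hia]
        exact h i (by simpa [hia] using hi)
    obtain ⟨c, hc⟩ := ih _ (hdep 1)
    obtain ⟨d, hd⟩ := ih _ (hdep (-1))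
    refine ⟨fun A => if a ∈ A then (c (A.erase a) - d (A.erase a)) / 2 else (c A + d A) / 2,
      fun σ => ?_⟩
    rw [Finset.sum_powerset_insert ha]
    have e1 : ∀ A ∈ S.powerset, a ∉ A := fun A hA h => ha (Finset.mem_powerset.1 hA h)
    have e2 : Ψ σ = (Ψ (Function.update σ a 1) + Ψ (Function.update σ a (-1))) / 2 +
        spin (σ a) * ((Ψ (Function.update σ a 1) - Ψ (Function.update σ a (-1))) / 2) := by
      rcases Int.units_eq_one_or (σ a) with h | h
      · have : Function.update σ a 1 = σ := by rw [← h, Function.update_eq_self]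
        rw [this, h]; simp [spin]; ring
      · have : Function.update σ a (-1) = σ := by rw [← h, Function.update_eq_self]
        rw [this, h]; simp [spin]; ring
    rw [e2, hc, hd, ← Finset.sum_add_distrib, ← Finset.sum_sub_distrib, Finset.sum_div,
      Finset.sum_div, Finset.mul_sum]
    congr 1
    · refine Finset.sum_congr rfl fun A hA => ?_
      simp only [if_neg (e1 A hA)]; ring
    · refine Finset.sum_congr rfl fun A hA => ?_
      simp only [if_pos (Finset.mem_insert_self _ _), Finset.erase_insert (e1 A hA),
        Finset.prod_insert (e1 A hA)]
      ring

/-! ### Pair interactions and the discrete circle -/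

/-- The energy `-½ ∑ k i j σ_i σ_j` of a pair interaction `k`. -/
noncomputable def pairEnergy {V : Type*} [Fintype V] (k : V → V → ℝ) (σ : V → ℤˣ) : ℝ :=
  -(1 / 2) * ∑ i, ∑ j, k i j * spin (σ i) * spin (σ j)

section Pair

variable {V : Type*} [Fintype V] [DecidableEq V]

theorem sum_abs_swap_sub_le (a b : V) (k : V → V → ℝ) :
    ∑ i, ∑ j, |k (Equiv.swap a b i) j - k i j| ≤ 2 * ∑ j, |k a j - k b j| := by
  set X := ∑ j, |k a j - k b j|
  have h0 : 0 ≤ X := Finset.sum_nonneg fun _ _ => abs_nonneg _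
  have : ∀ i, ∑ j, |k (Equiv.swap a b i) j - k i j| ≤
      (if i = a then X else 0) + (if i = b then X else 0) := by
    intro i
    by_cases hia : i = a
    · subst hia
      have : ∑ j, |k (Equiv.swap i b i) j - k i j| = X := by
        rw [Equiv.swap_apply_left]
        exact Finset.sum_congr rfl fun j _ => abs_sub_comm _ _
      rw [this, if_pos rfl]
      split_ifs <;> linarith
    · by_cases hib : i = b
      · subst hib
        rw [Equiv.swap_apply_right, if_neg hia, if_pos rfl, zero_add]
      · rw [Equiv.swap_apply_of_ne_of_ne hia hib, if_neg hia, if_neg hib]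
        simp
  refine (Finset.sum_le_sum fun i _ => this i).trans (le_of_eq ?_)
  rw [Finset.sum_add_distrib]
  simp [two_mul]

/-- The energy cost of exchanging two spins is controlled by how much the interaction differs
between the two sites. -/
theorem abs_pairEnergy_comp_swap_sub_le (k : V → V → ℝ) (a b : V) (σ : V → ℤˣ) :
    |pairEnergy k (σ ∘ Equiv.swap a b) - pairEnergy k σ| ≤
      ∑ j, |k a j - k b j| + ∑ i, |k i a - k i b| := by
  set s := Equiv.swap a b with hs
  have e1 : pairEnergy k (σ ∘ s) =
      -(1 / 2) * ∑ i, ∑ j, k (s i) (s j) * spin (σ i) * spin (σ j) := by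
    unfold pairEnergy
    congr 1
    rw [← Equiv.sum_comp s]
    refine Finset.sum_congr rfl fun i _ => ?_
    rw [← Equiv.sum_comp s]
    refine Finset.sum_congr rfl fun j _ => ?_
    simp [hs]
  have e2 : pairEnergy k (σ ∘ s) - pairEnergy k σ =
      -(1 / 2) * ∑ i, ∑ j, (k (s i) (s j) - k i j) * spin (σ i) * spin (σ j) := by
    rw [e1, pairEnergy, ← mul_sub, ← Finset.sum_sub_distrib]
    congr 1
    refine Finset.sum_congr rfl fun i _ => ?_
    rw [← Finset.sum_sub_distrib]
    exact Finset.sum_congr rfl fun j _ => by ring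
  have e3 : |∑ i, ∑ j, (k (s i) (s j) - k i j) * spin (σ i) * spin (σ j)| ≤
      ∑ i, ∑ j, (|k (s i) (s j) - k i (s j)| + |k i (s j) - k i j|) := by
    refine (Finset.abs_sum_le_sum_abs _ _).trans (Finset.sum_le_sum fun i _ => ?_)
    refine (Finset.abs_sum_le_sum_abs _ _).trans (Finset.sum_le_sum fun j _ => ?_)
    rw [abs_mul, abs_mul, abs_spin, abs_spin, mul_one, mul_one]
    exact abs_sub_le _ _ _
  have e4 : ∑ i, ∑ j, |k (s i) (s j) - k i (s j)| ≤ 2 * ∑ j, |k a j - k b j| := by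
    refine le_trans (le_of_eq ?_) (sum_abs_swap_sub_le a b k)
    exact Finset.sum_congr rfl fun i _ => Equiv.sum_comp s fun j => |k (s i) j - k i j|
  have e5 : ∑ i, ∑ j, |k i (s j) - k i j| ≤ 2 * ∑ i, |k i a - k i b| := by
    rw [Finset.sum_comm]
    exact sum_abs_swap_sub_le a b fun j i => k i j
  simp only [Finset.sum_add_distrib] at e3
  rw [e2, abs_mul]
  norm_num
  linarith

end Pair

section Circle

variable {N : ℕ}

theorem sum_valMinAbs (f : ℤ → ℝ) :
    ∑ z : ZMod (2 * N + 1), f z.valMinAbs = ∑ k ∈ Finset.range (2 * N + 1), f (k - N) := by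
  have hspec : ∀ (x : ZMod (2 * N + 1)) (y : ℤ), x.valMinAbs = y ↔
      x = y ∧ -(N : ℤ) ≤ y ∧ y ≤ N := fun x y => by
    rw [ZMod.valMinAbs_spec]
    refine and_congr_right fun _ => ?_
    rw [Set.mem_Ioc]; push_cast
    constructor <;> intro h <;> constructor <;> omega
  refine Finset.sum_bij' (fun z _ => (z.valMinAbs + N).toNat)
    (fun k _ => (((k : ℤ) - N : ℤ) : ZMod (2 * N + 1))) ?_ ?_ ?_ ?_ ?_
  · intro z _
    have := ((hspec z _).1 rfl).2
    rw [Finset.mem_range]; omega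
  · intro k _; exact Finset.mem_univ _
  · intro z _
    have h := (hspec z _).1 rfl
    have : (((z.valMinAbs + N).toNat : ℤ) - N : ℤ) = z.valMinAbs := by omega
    simp only [this]
    exact h.1.symm
  · intro k hk
    rw [Finset.mem_range] at hk
    have : ((((k : ℤ) - N : ℤ) : ZMod (2 * N + 1))).valMinAbs = (k : ℤ) - N :=
      (hspec _ _).2 ⟨rfl, by omega, by omega⟩
    simp only [this]
    omega
  · intro z _
    have h := (hspec z _).1 rfl
    congr 1
    omega

theorem sum_Icc_eq_sum_range (f : ℤ → ℝ) :
    ∑ w ∈ Finset.Icc (-(N : ℤ)) N, f w = ∑ k ∈ Finset.range (2 * N + 1), f (k - N) := by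
  refine Finset.sum_bij' (fun z _ => (z + N).toNat) (fun k _ => (k : ℤ) - N) ?_ ?_ ?_ ?_ ?_
  all_goals intro z hz
  all_goals simp only [Finset.mem_Icc, Finset.mem_range] at *
  any_goals omega
  congr 1; omega

theorem valMinAbs_add_one (z : ZMod (2 * N + 1)) :
    (z + 1).valMinAbs = if z.valMinAbs = N then -(N : ℤ) else z.valMinAbs + 1 := by
  have hm := ZMod.valMinAbs_mem_Ioc z
  rw [Set.mem_Ioc] at hm
  push_cast at hm
  rw [ZMod.valMinAbs_spec]
  split_ifs with h
  · refine ⟨?_, ?_⟩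
    · have h1 : z = ((N : ℤ) : ZMod (2 * N + 1)) := by rw [← h, ZMod.coe_valMinAbs]
      have h2 : ((2 * N + 1 : ℕ) : ZMod (2 * N + 1)) = 0 := ZMod.natCast_self _
      push_cast at h1 h2 ⊢
      rw [h1]
      linear_combination h2
    · rw [Set.mem_Ioc]; push_cast; constructor <;> omega
  · refine ⟨by simp, ?_⟩
    rw [Set.mem_Ioc]; push_cast; constructor <;> omega

/-- The variation around the circle of a function of the representative in `{-N, …, N}`: the
variation on the interval, plus the jump between the two end points. -/
theorem sum_abs_valMinAbs_add_one_sub (f : ℤ → ℝ) :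
    ∑ z : ZMod (2 * N + 1), |f (z + 1).valMinAbs - f z.valMinAbs| =
      ∑ k ∈ Finset.range (2 * N), |f ((k + 1 : ℕ) - N) - f (k - N)| + |f (-N) - f N| := by
  have := sum_valMinAbs (N := N) fun w => |f (if w = N then -(N : ℤ) else w + 1) - f w|
  simp only [valMinAbs_add_one]
  rw [this, Finset.sum_range_succ]
  congr 1
  · refine Finset.sum_congr rfl fun k hk => ?_
    rw [Finset.mem_range] at hk
    rw [if_neg (by omega)]
    congr 3
    push_cast; ring
  · have : ((2 * N : ℕ) : ℤ) - N = N := by push_cast; ring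
    rw [this, if_pos rfl]

end Circle

/-! ### The Kac kernel, energies and Gibbs weights -/

section Kernel

variable {K : ℝ → ℝ}

theorem IsKacProfile.intervalIntegrable_abs_deriv (hK : IsKacProfile K) (a b : ℝ) :
    IntervalIntegrable (fun u => |deriv K u|) volume a b :=
  hK.integrable_deriv.abs.intervalIntegrable

theorem IsKacProfile.abs_sub_le (hK : IsKacProfile K) {a b : ℝ} (hab : a ≤ b) :
    |K b - K a| ≤ ∫ u in a..b, |deriv K u| := by
  obtain ⟨L, hL⟩ := hK.lipschitz
  have h : AbsolutelyContinuousOnInterval K a b :=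
    (hL.lipschitzOnWith (s := Set.uIcc a b)).absolutelyContinuousOnInterval
  rw [← h.integral_deriv_eq_sub]
  have h1 := intervalIntegral.norm_integral_le_integral_norm (f := deriv K) (μ := volume) hab
  simpa only [Real.norm_eq_abs] using h1

theorem IsKacProfile.intervalIntegral_abs_deriv_le (hK : IsKacProfile K) {a b : ℝ} (hab : a ≤ b) :
    ∫ u in a..b, |deriv K u| ≤ ∫ u, |deriv K u| := by
  rw [intervalIntegral.integral_of_le hab]
  exact setIntegral_le_integral hK.integrable_deriv.abs
    (Eventually.of_forall fun _ => abs_nonneg _)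

theorem IsKacProfile.le_bound (hK : IsKacProfile K) (u : ℝ) :
    K u ≤ K 0 + ∫ u, |deriv K u| := by
  rcases le_total 0 u with h | h
  · have := (le_abs_self _).trans ((hK.abs_sub_le h).trans (hK.intervalIntegral_abs_deriv_le h))
    linarith
  · have := (hK.abs_sub_le h).trans (hK.intervalIntegral_abs_deriv_le h)
    have := (neg_le_abs _).trans this
    linarith

theorem IsKacProfile.sum_abs_sub_le (hK : IsKacProfile K) {γ : ℝ} (hγ : 0 ≤ γ) (N : ℕ) :
    ∑ k ∈ Finset.range (2 * N), |K (γ * (((k + 1 : ℕ) - N : ℤ) : ℝ)) - K (γ * ((k - N : ℤ) : ℝ))| ≤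
      ∫ u, |deriv K u| := by
  set p : ℕ → ℝ := fun k => γ * ((k - N : ℤ) : ℝ) with hp
  have hmono : ∀ {i j : ℕ}, i ≤ j → p i ≤ p j := fun {i j} h => by
    refine mul_le_mul_of_nonneg_left ?_ hγ
    push_cast
    have : (i : ℝ) ≤ j := by exact_mod_cast h
    linarith
  calc _ ≤ ∑ k ∈ Finset.range (2 * N), ∫ u in p k..p (k + 1), |deriv K u| :=
        Finset.sum_le_sum fun k _ => hK.abs_sub_le (hmono (Nat.le_succ k))
    _ = ∫ u in p 0..p (2 * N), |deriv K u| :=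
        intervalIntegral.sum_integral_adjacent_intervals fun k _ =>
          hK.intervalIntegrable_abs_deriv _ _
    _ ≤ _ := hK.intervalIntegral_abs_deriv_le (hmono (Nat.zero_le _))

/-- The Riemann sums normalizing the Kac kernel are bounded below: the profile is bounded below on
some interval, which contains at least a constant times `γ⁻¹` of the points `γ w`. -/
theorem IsKacProfile.exists_le_sum (hK : IsKacProfile K) :
    ∃ z > 0, ∃ γ₀ > 0, ∀ γ, 0 < γ → γ < γ₀ → ∀ᶠ N : ℕ in atTop,
      z ≤ ∑ w ∈ Finset.Icc (-(N : ℤ)) N, γ * K (γ * w) := by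
  obtain ⟨L, hL⟩ := hK.lipschitz
  obtain ⟨u₀, hu₀⟩ : ∃ u, 0 < K u := by
    by_contra! h
    exact absurd hK.integral_pos (not_lt.2 (integral_nonpos h))
  -- `K` is at least `K u₀ / 2` at distance at most `2 δ` from `u₀`
  set δ : ℝ := K u₀ / (4 * (L + 1)) with hδ
  have hL1 : (0 : ℝ) < L + 1 := by positivity
  have hδ0 : 0 < δ := by positivity
  refine ⟨δ * (K u₀ / 2), by positivity, δ, hδ0, fun γ hγ hγδ => ?_⟩
  set w₀ : ℤ := ⌊u₀ / γ⌋
  set n : ℕ := ⌊δ / γ⌋₊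
  have hn1 : δ / γ < n + 1 := Nat.lt_floor_add_one _
  have hn2 : (n : ℝ) ≤ δ / γ := Nat.floor_le (by positivity)
  have hK2 : ∀ j ∈ Finset.range (n + 1), K u₀ / 2 ≤ K (γ * ((w₀ + j : ℤ) : ℝ)) := by
    intro j hj
    have hj' : (j : ℝ) ≤ n := by exact_mod_cast Nat.lt_succ_iff.1 (Finset.mem_range.1 hj)
    have h1 : (w₀ : ℝ) ≤ u₀ / γ := Int.floor_le _
    have h2 : u₀ / γ < w₀ + 1 := Int.lt_floor_add_one _
    rw [le_div_iff₀ hγ] at h1 hn2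
    rw [div_lt_iff₀ hγ] at h2
    have h3 : |u₀ - γ * ((w₀ + j : ℤ) : ℝ)| ≤ 2 * δ := by
      have hj0 : (0 : ℝ) ≤ γ * j := by positivity
      have hj1 : γ * (j : ℝ) ≤ γ * n := by gcongr
      push_cast
      rw [abs_le]
      constructor <;> nlinarith
    have h4 := hL.dist_le_mul u₀ (γ * ((w₀ + j : ℤ) : ℝ))
    rw [Real.dist_eq, Real.dist_eq] at h4
    have h5 : (L : ℝ) * |u₀ - γ * ((w₀ + j : ℤ) : ℝ)| ≤ K u₀ / 2 := by
      calc (L : ℝ) * |u₀ - γ * ((w₀ + j : ℤ) : ℝ)| ≤ (L + 1) * (2 * δ) := by gcongr; linarith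
        _ = K u₀ / 2 := by rw [hδ]; field_simp; norm_num
    linarith [le_abs_self (K u₀ - K (γ * ((w₀ + j : ℤ) : ℝ)))]
  filter_upwards [eventually_ge_atTop (w₀.natAbs + n)] with N hN
  have hinj : Set.InjOn (fun j : ℕ => w₀ + (j : ℤ)) (Finset.range (n + 1)) :=
    fun i _ j _ h => by simpa using h
  have hsub : (Finset.range (n + 1)).image (fun j : ℕ => w₀ + (j : ℤ)) ⊆
      Finset.Icc (-(N : ℤ)) N := by
    intro w hw
    obtain ⟨j, hj, rfl⟩ := Finset.mem_image.1 hw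
    rw [Finset.mem_range] at hj
    rw [Finset.mem_Icc]; omega
  refine le_trans ?_ (Finset.sum_le_sum_of_subset_of_nonneg hsub
    fun w _ _ => mul_nonneg hγ.le (hK.nonneg _))
  rw [Finset.sum_image hinj]
  calc δ * (K u₀ / 2) ≤ (n + 1) * (γ * (K u₀ / 2)) := by
        rw [← mul_assoc]
        rw [div_lt_iff₀ hγ] at hn1
        exact mul_le_mul_of_nonneg_right hn1.le (by positivity)
    _ = ∑ _j ∈ Finset.range (n + 1), γ * (K u₀ / 2) := by simp
    _ ≤ _ := Finset.sum_le_sum fun j hj => mul_le_mul_of_nonneg_left (hK2 j hj) hγ.le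

theorem IsKacProfile.kacKernel_nonneg (hK : IsKacProfile K) {γ : ℝ} (hγ : 0 ≤ γ) (N : ℕ) (z : ℤ) :
    0 ≤ kacKernel K γ N z :=
  div_nonneg (mul_nonneg hγ (hK.nonneg _))
    (Finset.sum_nonneg fun _ _ => mul_nonneg hγ (hK.nonneg _))

/-- The Kac kernel is of order `γ`, and so is its total variation around the circle. -/
theorem IsKacProfile.exists_kacKernel_le (hK : IsKacProfile K) :
    ∃ κ > 0, ∃ γ₀ > 0, ∀ γ, 0 < γ → γ < γ₀ → ∀ᶠ N : ℕ in atTop,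
      (∀ z, kacKernel K γ N z ≤ κ * γ) ∧
      ∑ z : ZMod (2 * N + 1), |kacKernel K γ N (z + 1).valMinAbs - kacKernel K γ N z.valMinAbs| ≤
        κ * γ := by
  obtain ⟨z₀, hz₀, γ₀, hγ₀, h⟩ := hK.exists_le_sum
  set V := ∫ u, |deriv K u|
  have hV : 0 ≤ V := integral_nonneg fun _ => abs_nonneg _
  have hK0 := hK.nonneg 0
  refine ⟨(K 0 + V + 1) / z₀, by positivity, γ₀, hγ₀, fun γ hγ hγ' => ?_⟩
  filter_upwards [h γ hγ hγ'] with N hN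
  set Z := ∑ w ∈ Finset.Icc (-(N : ℤ)) N, γ * K (γ * w) with hZ
  have hZ0 : 0 < Z := hz₀.trans_le hN
  have hb : ∀ x, 0 ≤ x → x ≤ K 0 + V + 1 → γ * x / Z ≤ (K 0 + V + 1) / z₀ * γ := by
    intro x hx0 hx
    calc γ * x / Z ≤ γ * (K 0 + V + 1) / z₀ := by gcongr
      _ = _ := by ring
  refine ⟨fun z => hb _ (hK.nonneg _) (by linarith [hK.le_bound (γ * z)]), ?_⟩
  rw [sum_abs_valMinAbs_add_one_sub]
  -- by evenness there is no jump between the end points `-N` and `N`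
  have h1 : kacKernel K γ N (-N) = kacKernel K γ N N := by
    unfold kacKernel
    push_cast
    rw [mul_neg, hK.even]
  rw [h1, sub_self, abs_zero, add_zero]
  have h2 : ∀ k ∈ Finset.range (2 * N),
      |kacKernel K γ N ((k + 1 : ℕ) - N) - kacKernel K γ N (k - N)| =
      γ * |K (γ * (((k + 1 : ℕ) - N : ℤ) : ℝ)) - K (γ * ((k - N : ℤ) : ℝ))| / Z := by
    intro k _
    unfold kacKernel
    rw [← hZ, ← sub_div, ← mul_sub, abs_div, abs_mul, abs_of_pos hγ, abs_of_pos hZ0]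
  rw [Finset.sum_congr rfl h2, ← Finset.sum_div, ← Finset.mul_sum]
  exact hb _ (Finset.sum_nonneg fun _ _ => abs_nonneg _)
    (by linarith [hK.sum_abs_sub_le hγ.le N])

end Kernel

section Hamiltonian

variable {K : ℝ → ℝ} {γ : ℝ} {N : ℕ}

theorem abs_hamiltonian_exchange_sub_le (σ : Config N) (a : ZMod (2 * N + 1)) :
    |hamiltonian K γ N (exchange σ a) - hamiltonian K γ N σ| ≤
      2 * ∑ z : ZMod (2 * N + 1),
        |kacKernel K γ N (z + 1).valMinAbs - kacKernel K γ N z.valMinAbs| := by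
  refine (abs_pairEnergy_comp_swap_sub_le (fun i j => kacKernel K γ N (i - j).valMinAbs)
    a (a + 1) σ).trans (le_of_eq (Eq.trans ?_ (two_mul _).symm))
  congr 1
  · rw [← Equiv.sum_comp (Equiv.subLeft a)]
    refine Finset.sum_congr rfl fun z _ => ?_
    rw [abs_sub_comm]
    simp only [Equiv.subLeft_apply, sub_sub_cancel]
    congr 4; ring
  · rw [← Equiv.sum_comp (Equiv.addRight (a + 1))]
    refine Finset.sum_congr rfl fun z _ => ?_
    simp only [Equiv.coe_addRight, add_sub_cancel_right]
    congr 4; ring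

theorem IsKacProfile.abs_hamiltonian_le (hK : IsKacProfile K) (hγ : 0 ≤ γ) (σ : Config N) :
    |hamiltonian K γ N σ| ≤ 2 * N + 1 := by
  have h0 := hK.kacKernel_nonneg hγ N
  have h1 : ∀ i : ZMod (2 * N + 1), ∑ j, kacKernel K γ N (i - j).valMinAbs ≤ 1 := by
    intro i
    have : ∑ j, kacKernel K γ N (i - j).valMinAbs =
        ∑ z : ZMod (2 * N + 1), kacKernel K γ N z.valMinAbs :=
      Equiv.sum_comp (Equiv.subLeft i) fun z : ZMod (2 * N + 1) => kacKernel K γ N z.valMinAbs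
    rw [this, sum_valMinAbs, ← sum_Icc_eq_sum_range]
    unfold kacKernel
    rw [← Finset.sum_div]
    exact div_self_le_one _
  have h2 : |∑ i, ∑ j, kacKernel K γ N (i - j).valMinAbs * spin (σ i) * spin (σ j)| ≤
      2 * N + 1 := by
    calc _ ≤ ∑ i : ZMod (2 * N + 1), (1 : ℝ) := by
          refine (Finset.abs_sum_le_sum_abs _ _).trans (Finset.sum_le_sum fun i _ => ?_)
          refine (Finset.abs_sum_le_sum_abs _ _).trans (le_trans (le_of_eq ?_) (h1 i))
          refine Finset.sum_congr rfl fun j _ => ?_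
          rw [abs_mul, abs_mul, abs_spin, abs_spin, mul_one, mul_one, abs_of_nonneg (h0 _)]
      _ = 2 * N + 1 := by simp [ZMod.card]
  unfold hamiltonian
  rw [abs_mul]
  norm_num
  have := abs_nonneg (∑ i, ∑ j, kacKernel K γ N (i - j).valMinAbs * spin (σ i) * spin (σ j))
  linarith

theorem IsKacProfile.abs_blockHamiltonian_swap_sub_le (hK : IsKacProfile K) (hγ : 0 ≤ γ) {κ : ℝ}
    (hκ : ∀ z, kacKernel K γ N z ≤ κ) {ℓ : ℕ} (η : BlockConfig ℓ)
    (a b : Finset.Icc (-(ℓ : ℤ)) (ℓ : ℤ)) :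
    |blockHamiltonian K γ N ℓ (η ∘ Equiv.swap a b) - blockHamiltonian K γ N ℓ η| ≤
      2 * ((2 * ℓ + 1) * κ) := by
  have hd : ∀ x y, |kacKernel K γ N x - kacKernel K γ N y| ≤ κ := fun x y => by
    have := hK.kacKernel_nonneg hγ N x
    have := hK.kacKernel_nonneg hγ N y
    have := hκ x
    have := hκ y
    rw [abs_le]; constructor <;> linarith
  have hc : (Fintype.card (Finset.Icc (-(ℓ : ℤ)) (ℓ : ℤ)) : ℝ) = 2 * ℓ + 1 := by
    rw [Fintype.card_coe, Int.card_Icc]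
    have : ((ℓ : ℤ) + 1 - -ℓ).toNat = 2 * ℓ + 1 := by omega
    rw [this]; push_cast; ring
  refine (abs_pairEnergy_comp_swap_sub_le
    (fun u v : Finset.Icc (-(ℓ : ℤ)) (ℓ : ℤ) => kacKernel K γ N ((u : ℤ) - (v : ℤ))) a b η).trans ?_
  rw [two_mul]
  refine add_le_add ?_ ?_
  all_goals
    refine (Finset.sum_le_sum fun i _ => hd _ _).trans (le_of_eq ?_)
    rw [Finset.sum_const, Finset.card_univ, nsmul_eq_mul, hc]

end Hamiltonian

section Gibbs

open Classical in
/-- The weights of the Gibbs measure of the energy `H` on the configurations in `S`. -/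
noncomputable def gibbsWeight {C : Type*} [Fintype C] (β : ℝ) (H : C → ℝ) (S : Set C) (σ : C) : ℝ :=
  if σ ∈ S then Real.exp (-β * H σ) / ∑ τ with τ ∈ S, Real.exp (-β * H τ) else 0

theorem gibbsWeight_nonneg {C : Type*} [Fintype C] (β : ℝ) (H : C → ℝ) (S : Set C) (σ : C) :
    0 ≤ gibbsWeight β H S σ := by
  unfold gibbsWeight
  split_ifs
  · exact div_nonneg (Real.exp_nonneg _) (Finset.sum_nonneg fun _ _ => Real.exp_nonneg _)
  · exact le_rfl

theorem sum_gibbsWeight {C : Type*} [Fintype C] (β : ℝ) (H : C → ℝ) {S : Set C}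
    (hS : S.Nonempty) : ∑ σ, gibbsWeight β H S σ = 1 := by
  classical
  unfold gibbsWeight
  rw [← Finset.sum_filter, ← Finset.sum_div]
  refine div_self (ne_of_gt (Finset.sum_pos (fun _ _ => Real.exp_pos _) ?_))
  obtain ⟨σ, hσ⟩ := hS
  exact ⟨σ, by simp [hσ]⟩

theorem integral_gibbs {C : Type*} [Fintype C] [MeasurableSpace C] [MeasurableSingletonClass C]
    (β : ℝ) (H : C → ℝ) (S : Set C) (f : C → ℝ) :
    ∫ σ, f σ ∂(gibbs β H S) = ∑ σ, gibbsWeight β H S σ * f σ := by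
  classical
  unfold gibbs
  rw [integral_finsetSum_measure]
  · rw [Finset.sum_filter]
    refine Finset.sum_congr rfl fun σ _ => ?_
    unfold gibbsWeight
    split_ifs
    · rw [integral_smul_measure, integral_dirac, smul_eq_mul, ENNReal.toReal_ofReal
        (div_nonneg (Real.exp_nonneg _) (Finset.sum_nonneg fun _ _ => Real.exp_nonneg _))]
    · simp
  · intro σ _
    exact Integrable.of_finite.smul_measure ENNReal.ofReal_ne_top

theorem swapDefect_gibbsWeight_le {V : Type*} [Fintype V] [DecidableEq V] (β : ℝ)
    (H : (V → ℤˣ) → ℝ) (S : Set (V → ℤˣ)) (a b : V) {Δ : ℝ}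
    (hH : ∀ σ, |H (σ ∘ Equiv.swap a b) - H σ| ≤ Δ)
    (hS : ∀ σ, σ ∘ Equiv.swap a b ∈ S ↔ σ ∈ S) (hne : S.Nonempty) :
    swapDefect (gibbsWeight β H S) a b ≤ Real.exp (|β| * Δ) - 1 := by
  classical
  have key : ∀ σ, |gibbsWeight β H S (σ ∘ Equiv.swap a b) - gibbsWeight β H S σ| ≤
      gibbsWeight β H S σ * (Real.exp (|β| * Δ) - 1) := by
    intro σ
    unfold gibbsWeight
    simp only [hS]
    split_ifs with h
    · set Z := ∑ τ with τ ∈ S, Real.exp (-β * H τ)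
      have hZ : 0 ≤ Z := Finset.sum_nonneg fun _ _ => Real.exp_nonneg _
      rw [← sub_div, abs_div, abs_of_nonneg hZ, div_mul_eq_mul_div]
      gcongr
      have e1 : Real.exp (-β * H (σ ∘ Equiv.swap a b)) =
          Real.exp (-β * H σ) * Real.exp (-β * (H (σ ∘ Equiv.swap a b) - H σ)) := by
        rw [← Real.exp_add]; congr 1; ring
      rw [e1, ← mul_sub_one, abs_mul, abs_of_pos (Real.exp_pos _)]
      gcongr
      set x := -β * (H (σ ∘ Equiv.swap a b) - H σ)
      have hx : |x| ≤ |β| * Δ := by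
        rw [abs_mul, abs_neg]
        exact mul_le_mul_of_nonneg_left (hH σ) (abs_nonneg _)
      have h1 : Real.exp x ≤ Real.exp (|β| * Δ) :=
        Real.exp_le_exp.2 ((le_abs_self _).trans hx)
      have h2 : Real.exp (-(|β| * Δ)) ≤ Real.exp x :=
        Real.exp_le_exp.2 (abs_le.1 hx).1
      have h3 := Real.add_one_le_exp (-(|β| * Δ))
      have h4 := Real.add_one_le_exp (|β| * Δ)
      rw [abs_le]
      constructor <;> linarith
    · simp
  unfold swapDefect
  refine (Finset.sum_le_sum fun σ _ => key σ).trans (le_of_eq ?_)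
  rw [← Finset.sum_mul, sum_gibbsWeight β H hne, one_mul]

end Gibbs

/-! ### Entropy production of heat-bath dynamics -/

/-- The heat-bath rate for an energy cost `x`. -/
noncomputable def heatBath (x : ℝ) : ℝ := 1 / (1 + Real.exp x)

theorem heatBath_pos (x : ℝ) : 0 < heatBath x := by
  have := Real.exp_pos x
  unfold heatBath; positivity

theorem heatBath_le_one (x : ℝ) : heatBath x ≤ 1 := by
  have := Real.exp_pos x
  exact div_le_one_of_le₀ (by linarith) (by linarith)

theorem abs_heatBath_sub_half_le (x : ℝ) : |heatBath x - 1 / 2| ≤ |x| / 2 := by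
  have h0 := Real.exp_pos x
  have h1 : |1 - Real.exp x| ≤ |x| * (1 + Real.exp x) := by
    have e1 := Real.add_one_le_exp x
    have e2 := Real.add_one_le_exp (-x)
    have e3 : Real.exp (-x) * Real.exp x = 1 := by rw [← Real.exp_add]; simp
    have e4 : Real.exp x - 1 ≤ x * Real.exp x := by nlinarith
    have e5 := le_abs_self x
    have e6 := neg_le_abs x
    have e7 := abs_nonneg x
    rw [abs_le]
    constructor <;> nlinarith
  have h2 : heatBath x - 1 / 2 = (1 - Real.exp x) / (2 * (1 + Real.exp x)) := by
    unfold heatBath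
    field_simp
    ring
  rw [h2, abs_div, abs_of_pos (by positivity : 0 < 2 * (1 + Real.exp x)),
    div_le_iff₀ (by positivity)]
  linarith

theorem exp_neg_mul_heatBath (u w : ℝ) :
    Real.exp (-u) * heatBath (w - u) = Real.exp (-w) * heatBath (u - w) := by
  have h (a b : ℝ) : Real.exp (-a) * heatBath (b - a) = 1 / (Real.exp a + Real.exp b) := by
    unfold heatBath
    have := Real.exp_pos a
    have := Real.exp_pos b
    rw [Real.exp_neg, Real.exp_sub]
    field_simp
  rw [h, h, add_comm]

/-- A flux difference is controlled by the total flux and by the entropy production. -/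
theorem mul_abs_sub_le_add_entropyProduction {a b : ℝ} (ha : 0 < a) (hb : 0 < b) {l : ℝ} :
    l * |a - b| ≤ a + b + l ^ 2 / 4 * ((a - b) * (Real.log a - Real.log b)) := by
  have key : ∀ {a b : ℝ}, 0 < a → 0 < b → b ≤ a →
      l * |a - b| ≤ a + b + l ^ 2 / 4 * ((a - b) * (Real.log a - Real.log b)) := by
    intro a b ha hb hab
    have h1 : (a - b) / (a + b) ≤ Real.log a - Real.log b := by
      have := Real.one_sub_inv_le_log_of_pos (div_pos ha hb)
      rw [Real.log_div ha.ne' hb.ne'] at this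
      refine le_trans ?_ this
      rw [inv_div, one_sub_div ha.ne']
      have : 0 ≤ a - b := by linarith
      gcongr
      linarith
    have h2 : (a - b) * ((a - b) / (a + b)) ≤ (a - b) * (Real.log a - Real.log b) :=
      mul_le_mul_of_nonneg_left h1 (by linarith)
    have h3 : l * (a - b) ≤ a + b + l ^ 2 / 4 * ((a - b) * ((a - b) / (a + b))) := by
      rw [← sub_nonneg]
      have : a + b + l ^ 2 / 4 * ((a - b) * ((a - b) / (a + b))) - l * (a - b) =
          ((a + b) - l / 2 * (a - b)) ^ 2 / (a + b) := by
        field_simp; ring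
      rw [this]; positivity
    rw [abs_of_nonneg (by linarith)]
    have := mul_le_mul_of_nonneg_left h2 (by positivity : 0 ≤ l ^ 2 / 4)
    linarith
  rcases le_total b a with h | h
  · exact key ha hb h
  · have := key hb ha h
    rw [abs_sub_comm]
    linarith

theorem sum_comp_involutive {C : Type*} [Fintype C] {f : C → C}
    (hf : Function.Involutive f) (F : C → ℝ) :
    ∑ σ, F (f σ) = ∑ σ, F σ :=
  Equiv.sum_comp hf.toPerm F

theorem abs_sub_le_flux_add {C : Type*} {E : C → ℝ} {Δ : ℝ} {σ τ : C} (hΔ : |E τ - E σ| ≤ Δ)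
    {x y : ℝ} (hx : 0 ≤ x) (hy : 0 ≤ y) :
    |y - x| ≤ 2 * |x * heatBath (E τ - E σ) - y * heatBath (E σ - E τ)| + Δ * (x + y) := by
  have h1 := (abs_heatBath_sub_half_le (E τ - E σ))
  have h2 := (abs_heatBath_sub_half_le (E σ - E τ))
  rw [abs_sub_comm (E σ)] at h2
  set c := heatBath (E τ - E σ)
  set c' := heatBath (E σ - E τ)
  have h3 : y - x = -2 * (x * c - y * c') + (2 * x * (c - 1 / 2) - 2 * y * (c' - 1 / 2)) := by ring
  rw [h3]
  refine (abs_add_le _ _).trans (add_le_add ?_ ((abs_sub _ _).trans ?_))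
  · rw [abs_mul, abs_neg, abs_two]
  · rw [abs_mul, abs_mul (2 * y), abs_of_nonneg (by positivity : 0 ≤ 2 * x),
      abs_of_nonneg (by positivity : 0 ≤ 2 * y)]
    have h4 : 2 * x * |c - 1 / 2| ≤ 2 * x * (Δ / 2) := by gcongr; linarith
    have h5 : 2 * y * |c' - 1 / 2| ≤ 2 * y * (Δ / 2) := by gcongr; linarith
    linarith

/-- Time-integrated near invariance of a heat-bath dynamics with involutive moves `s i`. With speed
`l ^ 2` the entropy production is of order `l⁻²` times the initial entropy, which is at most of the
order of the size of the system, whatever the initial law. Adding the invariant probability to the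
law keeps logarithms finite. -/
theorem integral_sum_abs_sub_le {C I : Type*} [Fintype C] [Nonempty C] [Fintype I]
    {s : I → C → C} {E : C → ℝ} (hs : ∀ i, Function.Involutive (s i)) {B Δ : ℝ}
    (hB : ∀ σ, |E σ| ≤ B) (hΔ : ∀ i σ, |E (s i σ) - E σ| ≤ Δ) {l : ℝ} (hl : 0 < l)
    {p : ℝ → C → ℝ}
    (hp : ∀ t σ, HasDerivAt (fun t => p t σ) (l ^ 2 * ∑ i,
      (p t (s i σ) * heatBath (E σ - E (s i σ)) - p t σ * heatBath (E (s i σ) - E σ))) t)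
    (hp0 : ∀ t, 0 ≤ t → ∀ σ, 0 ≤ p t σ) (hp1 : ∀ t, 0 ≤ t → ∑ σ, p t σ = 1)
    {T : ℝ} (hT : 0 ≤ T) :
    ∫ t in (0 : ℝ)..T, ∑ i, ∑ σ, |p t (s i σ) - p t σ| ≤
      2 / l * (4 * Fintype.card I * T + (Real.log 2 + 2 * B + Real.log (Fintype.card C))) +
        6 * Δ * Fintype.card I * T := by
  set Z : ℝ := ∑ σ, Real.exp (-E σ) with hZ
  have hZ0 : 0 < Z := Finset.sum_pos (fun _ _ => Real.exp_pos _) Finset.univ_nonempty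
  set π : C → ℝ := fun σ => Real.exp (-E σ) / Z with hπ
  have hπ0 : ∀ σ, 0 < π σ := fun σ => div_pos (Real.exp_pos _) hZ0
  have hπ1 : ∑ σ, π σ = 1 := by
    rw [← Finset.sum_div]; exact div_self hZ0.ne'
  have hrev : ∀ i σ, π σ * heatBath (E (s i σ) - E σ) =
      π (s i σ) * heatBath (E σ - E (s i σ)) := fun i σ => by
    simp only [hπ, div_mul_eq_mul_div, exp_neg_mul_heatBath (E σ) (E (s i σ))]
  set g : ℝ → C → ℝ := fun t σ => p t σ + π σ with hg
  set a : ℝ → I → C → ℝ := fun t i σ => g t σ * heatBath (E (s i σ) - E σ) with ha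
  have ha' : ∀ t i σ, a t i (s i σ) = g t (s i σ) * heatBath (E σ - E (s i σ)) := fun t i σ => by
    simp only [ha, hs i σ]
  have hg0 : ∀ t, 0 ≤ t → ∀ σ, 0 < g t σ := fun t ht σ =>
    add_pos_of_nonneg_of_pos (hp0 t ht σ) (hπ0 σ)
  have hg1 : ∀ t, 0 ≤ t → ∑ σ, g t σ = 2 := fun t ht => by
    rw [Finset.sum_add_distrib, hp1 t ht, hπ1]; norm_num
  have ha0 : ∀ t, 0 ≤ t → ∀ i σ, 0 < a t i σ := fun t ht i σ =>
    mul_pos (hg0 t ht σ) (heatBath_pos _)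
  have ha1 : ∀ t, 0 ≤ t → ∀ i, ∑ σ, a t i σ ≤ 2 := fun t ht i => by
    rw [← hg1 t ht]
    exact Finset.sum_le_sum fun σ _ =>
      mul_le_of_le_one_right (hg0 t ht σ).le (heatBath_le_one _)
  have hpc : ∀ σ, Continuous fun t => p t σ := fun σ =>
    continuous_iff_continuousAt.2 fun t => (hp t σ).continuousAt
  have hgc : ∀ σ, Continuous fun t => g t σ := fun σ => (hpc σ).add continuous_const
  have hac : ∀ i σ, Continuous fun t => a t i σ := fun i σ => (hgc σ).mul continuous_const
  have hgd : ∀ t σ, HasDerivAt (fun t => g t σ) (l ^ 2 * ∑ i, (a t i (s i σ) - a t i σ)) t := by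
    intro t σ
    refine ((hp t σ).add_const (π σ)).congr_deriv ?_
    congr 1
    refine Finset.sum_congr rfl fun i _ => ?_
    rw [ha']
    simp only [ha, hg]
    linear_combination hrev i σ
  -- the relative entropy, up to an additive constant
  set h : ℝ → ℝ := fun t => ∑ σ, g t σ * (Real.log (g t σ) + E σ) with hh
  set F : ℝ → ℝ := fun t => ∑ i, ∑ σ, |a t i σ - a t i (s i σ)| with hF
  have hFc : Continuous F := continuous_finsetSum _ fun i _ => continuous_finsetSum _ fun σ _ =>
    ((hac i σ).sub (hac i (s i σ))).abs
  set h' : ℝ → ℝ := fun t => -(l ^ 2 / 2) * ∑ i, ∑ σ,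
    (a t i σ - a t i (s i σ)) * (Real.log (a t i σ) - Real.log (a t i (s i σ))) with hh'
  -- summation by parts along the involution `s i`
  have hflip : ∀ t i (φ : C → ℝ), ∑ σ, (a t i (s i σ) - a t i σ) * φ σ =
      -(1 / 2) * ∑ σ, (a t i σ - a t i (s i σ)) * (φ σ - φ (s i σ)) := by
    intro t i φ
    have h1 := sum_comp_involutive (hs i) fun σ => (a t i (s i σ) - a t i σ) * φ σ
    simp only [hs i _] at h1
    have h2 : ∑ σ, (a t i σ - a t i (s i σ)) * (φ σ - φ (s i σ)) =
        -(∑ σ, (a t i (s i σ) - a t i σ) * φ σ) - ∑ σ, (a t i σ - a t i (s i σ)) * φ (s i σ) := by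
      rw [← Finset.sum_neg_distrib, ← Finset.sum_sub_distrib]
      exact Finset.sum_congr rfl fun σ _ => by ring
    rw [h2, h1]; ring
  have hhd : ∀ t, 0 ≤ t → HasDerivAt h (h' t) t := by
    intro t ht
    have h1 : ∀ σ, HasDerivAt (fun t => g t σ * (Real.log (g t σ) + E σ))
        ((l ^ 2 * ∑ i, (a t i (s i σ) - a t i σ)) * (Real.log (g t σ) + E σ + 1)) t := by
      intro σ
      have := (hgd t σ).mul (((hgd t σ).log (hg0 t ht σ).ne').add_const (E σ))
      refine this.congr_deriv ?_
      rw [mul_div_cancel₀ _ (hg0 t ht σ).ne', ← mul_add_one]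
    have h2 := HasDerivAt.fun_sum fun σ (_ : σ ∈ Finset.univ) => h1 σ
    refine h2.congr_deriv (Eq.symm ?_)
    have h3 : ∑ σ, (l ^ 2 * ∑ i, (a t i (s i σ) - a t i σ)) * (Real.log (g t σ) + E σ + 1) =
        l ^ 2 * ∑ i, ∑ σ, (a t i (s i σ) - a t i σ) * (Real.log (g t σ) + E σ + 1) := by
      simp only [Finset.mul_sum, Finset.sum_mul]
      rw [Finset.sum_comm]
      simp only [mul_assoc]
    rw [h3]
    simp only [hflip]
    simp only [hh']
    rw [← Finset.mul_sum, ← mul_assoc]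
    congr 1
    · ring
    · refine Finset.sum_congr rfl fun i _ => Finset.sum_congr rfl fun σ _ => ?_
      congr 1
      have h4 := congrArg Real.log (exp_neg_mul_heatBath (E σ) (E (s i σ)))
      rw [Real.log_mul (Real.exp_ne_zero _) (heatBath_pos _).ne',
        Real.log_mul (Real.exp_ne_zero _) (heatBath_pos _).ne', Real.log_exp, Real.log_exp] at h4
      rw [ha']
      simp only [ha]
      rw [Real.log_mul (hg0 t ht _).ne' (heatBath_pos _).ne',
        Real.log_mul (hg0 t ht _).ne' (heatBath_pos _).ne']
      linarith
  -- flux differences are paid for by the decrease of the entropy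
  have hprod : ∀ t, 0 ≤ t → 1 / 2 * h' t ≤ 4 * Fintype.card I - l * F t := by
    intro t ht
    have h1 : l * F t ≤ ∑ i, ∑ σ, (a t i σ + a t i (s i σ) + l ^ 2 / 4 *
        ((a t i σ - a t i (s i σ)) * (Real.log (a t i σ) - Real.log (a t i (s i σ))))) := by
      rw [hF, Finset.mul_sum]
      refine Finset.sum_le_sum fun i _ => ?_
      rw [Finset.mul_sum]
      exact Finset.sum_le_sum fun σ _ =>
        mul_abs_sub_le_add_entropyProduction (ha0 t ht _ _) (ha0 t ht _ _)
    simp only [Finset.sum_add_distrib, ← Finset.mul_sum] at h1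
    have h2 : ∑ i, ∑ σ, a t i σ ≤ Fintype.card I * 2 := by
      refine (Finset.sum_le_sum fun i _ => ha1 t ht i).trans (le_of_eq ?_)
      simp
    have h3 : ∑ i, ∑ σ, a t i (s i σ) ≤ Fintype.card I * 2 := by
      refine (Finset.sum_le_sum fun i _ =>
        (sum_comp_involutive (hs i) fun σ => a t i σ).le.trans (ha1 t ht i)).trans (le_of_eq ?_)
      simp
    simp only [hh']
    linarith
  have hint : ∀ {u : ℝ → ℝ}, Continuous u → IntervalIntegrable u volume 0 T :=
    fun hu => hu.intervalIntegrable _ _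
  have hF1 : l * ∫ t in (0 : ℝ)..T, F t ≤ 4 * Fintype.card I * T + 1 / 2 * (h 0 - h T) := by
    have := intervalIntegral.sub_le_integral_of_hasDeriv_right_of_le (g := fun t => 1 / 2 * h t)
      (g' := fun t => 1 / 2 * h' t) (φ := fun t => 4 * Fintype.card I - l * F t) hT
      (fun t ht => ((hhd t ht.1).const_mul _).continuousAt.continuousWithinAt)
      (fun t ht => ((hhd t ht.1.le).const_mul _).hasDerivWithinAt)
      ((continuous_const.sub (continuous_const.mul hFc)).continuousOn.integrableOn_compact
        isCompact_Icc) (fun t ht => hprod t ht.1.le)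
    have hlF : Continuous fun t => l * F t := continuous_const.mul hFc
    rw [intervalIntegral.integral_sub (by simp) (hint hlF),
      intervalIntegral.integral_const_mul l, intervalIntegral.integral_const, smul_eq_mul] at this
    linarith
  have hZB : Real.log Z ≤ Real.log (Fintype.card C) + B := by
    have h1 : Z ≤ Fintype.card C * Real.exp B := by
      rw [hZ]
      calc _ ≤ ∑ _σ : C, Real.exp B := Finset.sum_le_sum fun σ _ =>
            Real.exp_le_exp.2 ((neg_le_abs _).trans (hB σ))
        _ = _ := by simp
    refine (Real.log_le_log hZ0 h1).trans (le_of_eq ?_)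
    rw [Real.log_mul (by simp) (Real.exp_ne_zero _), Real.log_exp]
  have hπl : ∀ σ, Real.log (π σ) = -E σ - Real.log Z := fun σ => by
    rw [hπ, Real.log_div (Real.exp_ne_zero _) hZ0.ne', Real.log_exp]
  -- since `g ≥ π`, the relative entropy of `g` is nonnegative term by term
  have hhT : -(2 * Real.log Z) ≤ h T := by
    rw [← hg1 T hT, hh, Finset.sum_mul, ← Finset.sum_neg_distrib]
    refine Finset.sum_le_sum fun σ _ => ?_
    rw [← mul_neg]
    refine mul_le_mul_of_nonneg_left ?_ (hg0 T hT σ).le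
    have h1 : Real.log (π σ) ≤ Real.log (g T σ) :=
      Real.log_le_log (hπ0 σ) (le_add_of_nonneg_left (hp0 T hT σ))
    rw [hπl] at h1
    linarith
  have hh0 : h 0 ≤ 2 * (Real.log 2 + B) := by
    rw [hh]
    simp only
    rw [← hg1 0 le_rfl, Finset.sum_mul]
    refine Finset.sum_le_sum fun σ _ => mul_le_mul_of_nonneg_left ?_ (hg0 0 le_rfl σ).le
    have h1 : g 0 σ ≤ 2 := by
      rw [← hg1 0 le_rfl]
      exact Finset.single_le_sum (f := g 0) (fun τ _ => (hg0 0 le_rfl τ).le) (Finset.mem_univ σ)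
    rw [hg1 0 le_rfl]
    exact add_le_add (Real.log_le_log (hg0 0 le_rfl σ) h1) ((le_abs_self _).trans (hB σ))
  have hF2 : ∫ t in (0 : ℝ)..T, F t ≤ 1 / l * (4 * Fintype.card I * T +
      (Real.log 2 + 2 * B + Real.log (Fintype.card C))) := by
    rw [one_div, inv_mul_eq_div, le_div_iff₀' hl]
    linarith
  have hdef : ∀ t ∈ Set.Icc 0 T, ∑ i, ∑ σ, |p t (s i σ) - p t σ| ≤
      2 * F t + 6 * Δ * Fintype.card I := by
    intro t ht
    have h1 : ∀ i σ, |p t (s i σ) - p t σ| ≤ 2 * |a t i σ - a t i (s i σ)| +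
        Δ * (g t σ + g t (s i σ)) + Δ * (π σ + π (s i σ)) := by
      intro i σ
      have e1 := abs_sub_le_flux_add (hΔ i σ) (hg0 t ht.1 σ).le (hg0 t ht.1 (s i σ)).le
      have e2 := abs_sub_le_flux_add (hΔ i σ) (hπ0 σ).le (hπ0 (s i σ)).le
      rw [hrev, sub_self, abs_zero, mul_zero, zero_add] at e2
      rw [ha']
      have e3 : p t (s i σ) - p t σ = (g t (s i σ) - g t σ) - (π (s i σ) - π σ) := by
        simp only [hg]; ring
      rw [e3]
      refine (abs_sub _ _).trans ?_
      linarith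
    have h2 : ∀ i, ∑ σ, |p t (s i σ) - p t σ| ≤
        2 * ∑ σ, |a t i σ - a t i (s i σ)| + 6 * Δ := by
      intro i
      refine (Finset.sum_le_sum fun σ _ => h1 i σ).trans (le_of_eq ?_)
      simp only [Finset.sum_add_distrib, ← Finset.mul_sum]
      rw [sum_comp_involutive (hs i) (g t), sum_comp_involutive (hs i) π, hg1 t ht.1, hπ1]
      ring
    refine (Finset.sum_le_sum fun i _ => h2 i).trans (le_of_eq ?_)
    simp only [Finset.sum_add_distrib, ← Finset.mul_sum, hF]
    simp; ring
  calc ∫ t in (0 : ℝ)..T, ∑ i, ∑ σ, |p t (s i σ) - p t σ|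
      ≤ ∫ t in (0 : ℝ)..T, (2 * F t + 6 * Δ * Fintype.card I) :=
        intervalIntegral.integral_mono_on hT
          (hint (continuous_finsetSum _ fun i _ => continuous_finsetSum _ fun σ _ =>
            ((hpc _).sub (hpc σ)).abs))
          (hint ((continuous_const.mul hFc).add continuous_const)) hdef
    _ = 2 * (∫ t in (0 : ℝ)..T, F t) + 6 * Δ * Fintype.card I * T := by
        have hlF : Continuous fun t => 2 * F t := continuous_const.mul hFc
        rw [intervalIntegral.integral_add (hint hlF) (by simp),
          intervalIntegral.integral_const_mul, intervalIntegral.integral_const, smul_eq_mul]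
        ring
    _ ≤ _ := by
        have : 2 / l * (4 * Fintype.card I * T + (Real.log 2 + 2 * B + Real.log (Fintype.card C))) =
          2 * (1 / l * (4 * Fintype.card I * T +
            (Real.log 2 + 2 * B + Real.log (Fintype.card C)))) := by ring
        rw [this]
        linarith

/-! ### Block averages and canonical means -/

section SwapPath

variable {V : Type*} [Fintype V] [DecidableEq V]

theorem swapDefect_nonneg (ρ : (V → ℤˣ) → ℝ) (a b : V) : 0 ≤ swapDefect ρ a b :=
  Finset.sum_nonneg fun _ _ => abs_nonneg _

theorem swapDefect_comm (ρ : (V → ℤˣ) → ℝ) (a b : V) : swapDefect ρ a b = swapDefect ρ b a := by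
  unfold swapDefect
  rw [Equiv.swap_comm]

/-- Exchanging two distant sites amounts to conjugating a shorter exchange by a neighbour
exchange. -/
theorem swapDefect_le_add (ρ : (V → ℤˣ) → ℝ) {a b c : V} (hab : a ≠ b) (hac : a ≠ c) :
    swapDefect ρ a c ≤ swapDefect ρ a b + 2 * swapDefect ρ b c := by
  set s := Equiv.swap b c
  set t := Equiv.swap a b
  have hst : ∀ σ : V → ℤˣ, σ ∘ Equiv.swap a c = ((σ ∘ s) ∘ t) ∘ s := fun σ => by
    rw [Equiv.swap_comm a c, ← Equiv.swap_mul_swap_mul_swap hab hac]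
    rfl
  have h1 : swapDefect ρ a c ≤ ∑ σ : V → ℤˣ, |ρ (((σ ∘ s) ∘ t) ∘ s) - ρ ((σ ∘ s) ∘ t)| +
      ∑ σ : V → ℤˣ, |ρ ((σ ∘ s) ∘ t) - ρ (σ ∘ s)| + ∑ σ : V → ℤˣ, |ρ (σ ∘ s) - ρ σ| := by
    unfold swapDefect
    rw [← Finset.sum_add_distrib, ← Finset.sum_add_distrib]
    refine Finset.sum_le_sum fun σ _ => ?_
    rw [hst]
    exact (abs_sub_le _ (ρ (σ ∘ s)) _).trans (add_le_add_left (abs_sub_le _ _ _) _)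
  rw [sum_comp_perm s (fun σ => |ρ ((σ ∘ t) ∘ s) - ρ (σ ∘ t)|),
    sum_comp_perm t (fun σ => |ρ (σ ∘ s) - ρ σ|),
    sum_comp_perm s (fun σ => |ρ (σ ∘ t) - ρ σ|)] at h1
  refine h1.trans (le_of_eq ?_)
  unfold swapDefect
  ring

theorem swapDefect_path_le (ρ : (V → ℤˣ) → ℝ) {v : ℕ → V} {n : ℕ}
    (hv : Set.InjOn v (Set.Iic n)) {i j : ℕ} (hi : i ≤ n) (hj : j ≤ n) :
    swapDefect ρ (v i) (v j) ≤ 2 * ∑ k ∈ Finset.range n, swapDefect ρ (v k) (v (k + 1)) := by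
  have key : ∀ i m, i + m ≤ n → swapDefect ρ (v i) (v (i + m)) ≤
      2 * ∑ k ∈ Finset.Ico i (i + m), swapDefect ρ (v k) (v (k + 1)) := by
    intro i m
    induction m with
    | zero => intro _; simp [swapDefect]
    | succ m ih =>
      intro hm
      rw [← add_assoc, Finset.sum_Ico_succ_top (Nat.le_add_right _ _), mul_add]
      rcases Nat.eq_zero_or_pos m with rfl | hm0
      · have := swapDefect_nonneg ρ (v i) (v (i + 1))
        simp only [add_zero, Finset.Ico_self, Finset.sum_empty]
        linarith
      · refine (swapDefect_le_add ρ (b := v (i + m)) (fun h => ?_) (fun h => ?_)).trans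
          (add_le_add_left (ih (by omega)) _)
        · have := hv (Set.mem_Iic.2 (by omega)) (Set.mem_Iic.2 (by omega)) h
          omega
        · have := hv (Set.mem_Iic.2 (by omega)) (Set.mem_Iic.2 (by omega)) h
          omega
  have hsub : ∀ i j : ℕ, j ≤ n → ∑ k ∈ Finset.Ico i j, swapDefect ρ (v k) (v (k + 1)) ≤
      ∑ k ∈ Finset.range n, swapDefect ρ (v k) (v (k + 1)) := fun i j hj =>
    Finset.sum_le_sum_of_subset_of_nonneg
      (fun k hk => Finset.mem_range.2 (by rw [Finset.mem_Ico] at hk; omega))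
      fun _ _ _ => swapDefect_nonneg _ _ _
  rcases le_total i j with h | h
  · obtain ⟨m, rfl⟩ := Nat.exists_eq_add_of_le h
    exact (key i m hj).trans (mul_le_mul_of_nonneg_left (hsub i _ hj) zero_le_two)
  · obtain ⟨m, rfl⟩ := Nat.exists_eq_add_of_le h
    rw [swapDefect_comm]
    exact (key j m hi).trans (mul_le_mul_of_nonneg_left (hsub j _ hi) zero_le_two)

end SwapPath

section Block

variable {r ℓ N : ℕ} {Ψ : (ℤ → ℤˣ) → ℝ} {c : Finset ℤ → ℝ}

/-- The polynomial obtained from the expansion `∑ c A ∏_{i ∈ A} σ_i` of an observable by replacing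
each spin by `m`: the mean of the observable under the product measure with mean `m`. -/
noncomputable def meanPolynomial (r : ℕ) (c : Finset ℤ → ℝ) (m : ℝ) : ℝ :=
  ∑ A ∈ (Finset.Icc (-(r : ℤ)) r).powerset, c A * m ^ A.card

/-- The size of the coefficients of an expansion, weighted by the degrees. -/
noncomputable def coeffSize (r : ℕ) (c : Finset ℤ → ℝ) : ℝ :=
  ∑ A ∈ (Finset.Icc (-(r : ℤ)) r).powerset, |c A| * (12 * (A.card + 1) ^ 2)

theorem coeffSize_nonneg (r : ℕ) (c : Finset ℤ → ℝ) : 0 ≤ coeffSize r c :=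
  Finset.sum_nonneg fun _ _ => by positivity

theorem card_block (ℓ : ℕ) : Fintype.card (Finset.Icc (-(ℓ : ℤ)) (ℓ : ℤ)) = 2 * ℓ + 1 := by
  rw [Fintype.card_coe, Int.card_Icc]; omega

/-- The canonical block mean of an observable is close to its mean under the product measure. -/
theorem abs_canonicalMean_sub_le {K : ℝ → ℝ} (hK : IsKacProfile K) {γ β κ m : ℝ} (hγ : 0 ≤ γ)
    (hκ : ∀ z, kacKernel K γ N z ≤ κ) (hr : r ≤ ℓ)
    (hc : ∀ σ, Ψ σ = ∑ A ∈ (Finset.Icc (-(r : ℤ)) r).powerset, c A * ∏ i ∈ A, spin (σ i))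
    (hm : (blockSector ℓ m).Nonempty) :
    |canonicalMean K γ β N Ψ ℓ m - meanPolynomial r c m| ≤
      coeffSize r c * (Real.exp (|β| * (2 * ((2 * ℓ + 1) * κ))) - 1 + 1 / (2 * ℓ + 1)) := by
  set w := gibbsWeight β (blockHamiltonian K γ N ℓ) (blockSector ℓ m) with hw
  set D := Real.exp (|β| * (2 * ((2 * ℓ + 1) * κ))) - 1 with hDdef
  have hinv : ∀ (a b : Finset.Icc (-(ℓ : ℤ)) (ℓ : ℤ)) (η : BlockConfig ℓ),
      η ∘ Equiv.swap a b ∈ blockSector ℓ m ↔ η ∈ blockSector ℓ m := fun a b η => by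
    unfold blockSector
    rw [Set.mem_ofPred_eq, Set.mem_ofPred_eq]
    have : ∑ u, spin ((η ∘ Equiv.swap a b) u) = ∑ u, spin (η u) :=
      Equiv.sum_comp (Equiv.swap a b) fun u => spin (η u)
    rw [this]
  have hD : ∀ a b : Finset.Icc (-(ℓ : ℤ)) (ℓ : ℤ), swapDefect w (id a) (id b) ≤ D := fun a b =>
    swapDefect_gibbsWeight_le β _ _ a b
      (fun η => hK.abs_blockHamiltonian_swap_sub_le hγ hκ η a b) (hinv a b) hm
  have hD0 : 0 ≤ D := (swapDefect_nonneg _ _ _).trans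
    (hD ⟨0, by simp⟩ ⟨0, by simp⟩)
  have hmean : ∀ η, w η ≠ 0 → siteMean id η = m := fun η hη => by
    have : η ∈ blockSector ℓ m := by
      by_contra h
      exact hη (if_neg h)
    rw [siteMean, card_block]
    push_cast
    exact this
  have hterm : ∀ A ∈ (Finset.Icc (-(r : ℤ)) r).powerset,
      |∑ η, w η * ∏ i ∈ A, spin (blockExtend η i) - m ^ A.card| ≤
        12 * (A.card + 1) ^ 2 * (D + 1 / (2 * ℓ + 1)) := by
    intro A hA
    have hsub : ∀ i ∈ A, i ∈ Finset.Icc (-(ℓ : ℤ)) (ℓ : ℤ) := fun i hi => by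
      have := Finset.mem_powerset.1 hA hi
      rw [Finset.mem_Icc] at this ⊢
      omega
    set B : Finset (Finset.Icc (-(ℓ : ℤ)) (ℓ : ℤ)) := A.subtype (· ∈ Finset.Icc (-(ℓ : ℤ)) (ℓ : ℤ))
    have hB : B.card = A.card := by
      rw [Finset.card_subtype, Finset.filter_true_of_mem hsub]
    have hprod : ∀ η : BlockConfig ℓ, ∏ i ∈ A, spin (blockExtend η i) =
        ∏ v ∈ B, spin (η (id v)) := fun η => by
      rw [← Finset.prod_subtype_of_mem _ hsub]
      refine Finset.prod_congr rfl fun v _ => ?_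
      rw [blockExtend, dif_pos v.2]
      rfl
    have := abs_sum_mul_prod_spin_sub_pow_le Function.injective_id
      (fun η => gibbsWeight_nonneg β (blockHamiltonian K γ N ℓ) (blockSector ℓ m) η)
      (sum_gibbsWeight _ _ hm) hD m hmean B
    simp only [hprod]
    rw [hB, card_block] at this
    refine this.trans ?_
    push_cast
    set a : ℝ := (A.card : ℝ)
    have ha : 0 ≤ a := Nat.cast_nonneg _
    have h1 : (0 : ℝ) ≤ 1 / (2 * ℓ + 1) := by positivity
    have h2 : 2 * a / (2 * (ℓ : ℝ) + 1) = 2 * a * (1 / (2 * ℓ + 1)) := by ring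
    rw [h2]
    set b : ℝ := 1 / (2 * ℓ + 1)
    have h3 : a * (D + 2 * a * b) ≤ 12 * (a + 1) ^ 2 * D + 12 * (a + 1) ^ 2 * b := by
      have : a ≤ 12 * (a + 1) ^ 2 := by nlinarith
      have : a * (2 * a) ≤ 12 * (a + 1) ^ 2 := by nlinarith
      nlinarith
    linarith
  have hexp : canonicalMean K γ β N Ψ ℓ m - meanPolynomial r c m =
      ∑ A ∈ (Finset.Icc (-(r : ℤ)) r).powerset,
        c A * (∑ η, w η * ∏ i ∈ A, spin (blockExtend η i) - m ^ A.card) := by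
    unfold canonicalMean meanPolynomial
    rw [integral_gibbs]
    simp only [mul_sub, Finset.sum_sub_distrib, hc, Finset.mul_sum]
    rw [Finset.sum_comm]
    congr 1
    exact Finset.sum_congr rfl fun A _ => Finset.sum_congr rfl fun η _ => by ring
  rw [hexp, coeffSize, Finset.sum_mul]
  refine (Finset.abs_sum_le_sum_abs _ _).trans (Finset.sum_le_sum fun A hA => ?_)
  rw [abs_mul, mul_assoc]
  exact mul_le_mul_of_nonneg_left (hterm A hA) (abs_nonneg _)

theorem injective_add_intCast (hℓ : ℓ ≤ N) (x : ZMod (2 * N + 1)) :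
    Function.Injective fun w : Finset.Icc (-(ℓ : ℤ)) (ℓ : ℤ) =>
      x + ((w : ℤ) : ZMod (2 * N + 1)) := by
  intro u w h
  have h1 := add_left_cancel h
  rw [ZMod.intCast_eq_intCast_iff_dvd_sub] at h1
  have hu := Finset.mem_Icc.1 u.2
  have hw := Finset.mem_Icc.1 w.2
  refine Subtype.ext ?_
  obtain ⟨k, hk⟩ := h1
  push_cast at hk
  have : k = 0 := by
    by_contra hk0
    rcases lt_or_gt_of_ne hk0 with h | h
    · nlinarith
    · nlinarith
  subst this
  linarith

theorem siteMean_eq_blockAverage (x : ZMod (2 * N + 1)) (σ : Config N) :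
    siteMean (fun w : Finset.Icc (-(ℓ : ℤ)) (ℓ : ℤ) => x + ((w : ℤ) : ZMod (2 * N + 1))) σ =
      blockAverage ℓ x σ := by
  unfold siteMean blockAverage
  rw [card_block]
  push_cast
  congr 1
  exact Finset.sum_coe_sort (Finset.Icc (-(ℓ : ℤ)) (ℓ : ℤ))
    fun y => spin (σ (x + (y : ZMod (2 * N + 1))))

theorem blockSector_blockAverage_nonempty (x : ZMod (2 * N + 1)) (σ : Config N) :
    (blockSector ℓ (blockAverage ℓ x σ)).Nonempty := by
  refine ⟨fun w => σ (x + ((w : ℤ) : ZMod (2 * N + 1))), ?_⟩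
  rw [← siteMean_eq_blockAverage]
  unfold siteMean
  rw [card_block]
  push_cast
  rfl

/-- Block averages of an observable are close, in mean under a law which is nearly invariant under
exchanges inside the block, to the product mean at the block magnetization. -/
theorem sum_mul_abs_blockObservable_sub_le (hr : r ≤ ℓ) (hℓ : ℓ ≤ N)
    (hc : ∀ σ, Ψ σ = ∑ A ∈ (Finset.Icc (-(r : ℤ)) r).powerset, c A * ∏ i ∈ A, spin (σ i))
    {p : Config N → ℝ} (hp : ∀ σ, 0 ≤ p σ) (hp1 : ∑ σ, p σ ≤ 1) (x : ZMod (2 * N + 1)) {D θ : ℝ}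
    (hθ : 0 < θ)
    (hD : ∀ u w : Finset.Icc (-(ℓ : ℤ)) (ℓ : ℤ),
      swapDefect p (x + ((u : ℤ) : ZMod (2 * N + 1))) (x + ((w : ℤ) : ZMod (2 * N + 1))) ≤ D) :
    ∑ σ, p σ * |(∑ y ∈ Finset.range (ℓ - r + 1), Ψ (shiftConfig (x + (y : ZMod (2 * N + 1))) σ)) /
        (ℓ - r + 1 : ℕ) - meanPolynomial r c (blockAverage ℓ x σ)| ≤
      coeffSize r c * (θ + (D + 1 / (ℓ - r + 1 : ℕ)) / θ) := by
  set q := ℓ - r + 1 with hq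
  have hq0 : (0 : ℝ) < q := by positivity
  have hD0 : 0 ≤ D := (swapDefect_nonneg _ _ _).trans (hD ⟨0, by simp⟩ ⟨0, by simp⟩)
  set e : Finset.Icc (-(ℓ : ℤ)) (ℓ : ℤ) → ZMod (2 * N + 1) :=
    fun w => x + ((w : ℤ) : ZMod (2 * N + 1)) with he
  have heinj : Function.Injective e := injective_add_intCast hℓ x
  set s : Finset.Icc (-(r : ℤ)) (r : ℤ) → Fin q → Finset.Icc (-(ℓ : ℤ)) (ℓ : ℤ) :=
    fun i y => ⟨(i : ℤ) + (y : ℕ), by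
      have h1 := Finset.mem_Icc.1 i.2
      have h2 := y.2
      rw [Finset.mem_Icc]; omega⟩ with hs
  have hsinj : ∀ i, Function.Injective (s i) := fun i y y' h => by
    have := congrArg Subtype.val h
    simp only [hs] at this
    exact Fin.ext (by omega)
  have hsne : ∀ i j, i ≠ j → ∀ y, s i y ≠ s j y := fun i j hij y h => hij <| by
    have := congrArg Subtype.val h
    simp only [hs] at this
    exact Subtype.ext (by omega)
  have : Nonempty (Fin q) := ⟨⟨0, by omega⟩⟩
  set R : Finset ℤ → Config N → ℝ := fun A σ =>
    (∑ y : Fin q, ∏ i ∈ A, spin (shiftConfig (x + ((y : ℕ) : ZMod (2 * N + 1))) σ i)) / q -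
      blockAverage ℓ x σ ^ A.card with hR
  have hterm : ∀ A ∈ (Finset.Icc (-(r : ℤ)) r).powerset, ∑ σ, p σ * |R A σ| ≤
      12 * (A.card + 1) ^ 2 * (θ + (D + 1 / q) / θ) := by
    intro A hA
    have hsub : ∀ i ∈ A, i ∈ Finset.Icc (-(r : ℤ)) (r : ℤ) := Finset.mem_powerset.1 hA
    set B : Finset (Finset.Icc (-(r : ℤ)) (r : ℤ)) := A.subtype (· ∈ Finset.Icc (-(r : ℤ)) (r : ℤ))
    have hB : B.card = A.card := by
      rw [Finset.card_subtype, Finset.filter_true_of_mem hsub]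
    have hprod : ∀ (σ : Config N) (y : Fin q),
        ∏ i ∈ A, spin (shiftConfig (x + ((y : ℕ) : ZMod (2 * N + 1))) σ i) =
        ∏ i ∈ B, spin (σ (e (s i y))) := fun σ y => by
      rw [← Finset.prod_subtype_of_mem _ hsub]
      refine Finset.prod_congr rfl fun i _ => ?_
      simp only [shiftConfig, he, hs]
      congr 2
      push_cast
      ring
    have := sum_mul_abs_average_sub_pow_le heinj hp hp1 hD hsinj hsne hθ B
    rw [hB, Fintype.card_fin] at this
    simp only [hR, hprod, ← siteMean_eq_blockAverage]
    refine this.trans ?_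
    set a : ℝ := (A.card : ℝ)
    have ha : 0 ≤ a := Nat.cast_nonneg _
    have h1 : (0 : ℝ) ≤ 1 / q := by positivity
    have h2 : 12 * a / (q : ℝ) = 12 * a * (1 / q) := by ring
    rw [h2]
    set b : ℝ := 1 / q
    have h3 : 2 * D + 12 * a * b ≤ 12 * (a + 1) * (D + b) := by nlinarith
    calc a * (θ + (2 * D + 12 * a * b) / θ)
        ≤ (a + 1) * (12 * (a + 1) * θ + 12 * (a + 1) * (D + b) / θ) := by
          gcongr
          · linarith
          · nlinarith
      _ = _ := by ring
  have hexp : ∀ σ, (∑ y ∈ Finset.range q, Ψ (shiftConfig (x + (y : ZMod (2 * N + 1))) σ)) / q -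
      meanPolynomial r c (blockAverage ℓ x σ) =
      ∑ A ∈ (Finset.Icc (-(r : ℤ)) r).powerset, c A * R A σ := by
    intro σ
    rw [meanPolynomial, Finset.sum_range]
    simp only [hc, hR, mul_sub, Finset.sum_sub_distrib]
    rw [Finset.sum_comm, Finset.sum_div]
    congr 1
    refine Finset.sum_congr rfl fun A _ => ?_
    rw [← Finset.mul_sum, mul_div_assoc]
  calc ∑ σ, p σ * |(∑ y ∈ Finset.range q, Ψ (shiftConfig (x + (y : ZMod (2 * N + 1))) σ)) / q -
      meanPolynomial r c (blockAverage ℓ x σ)|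
      ≤ ∑ σ, ∑ A ∈ (Finset.Icc (-(r : ℤ)) r).powerset, |c A| * (p σ * |R A σ|) := by
        refine Finset.sum_le_sum fun σ _ => ?_
        rw [hexp]
        refine (mul_le_mul_of_nonneg_left (Finset.abs_sum_le_sum_abs _ _) (hp σ)).trans
          (le_of_eq ?_)
        rw [Finset.mul_sum]
        exact Finset.sum_congr rfl fun A _ => by rw [abs_mul]; ring
    _ = ∑ A ∈ (Finset.Icc (-(r : ℤ)) r).powerset, |c A| * ∑ σ, p σ * |R A σ| := by
        rw [Finset.sum_comm]
        simp only [Finset.mul_sum]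
    _ ≤ _ := by
        rw [coeffSize, Finset.sum_mul]
        refine Finset.sum_le_sum fun A hA => ?_
        rw [mul_assoc]
        exact mul_le_mul_of_nonneg_left (hterm A hA) (abs_nonneg _)

/-- The block of radius `ℓ` around `x` inherits the near invariance under neighbour exchanges. -/
theorem swapDefect_block_le (hℓ : ℓ ≤ N) (p : Config N → ℝ) (x : ZMod (2 * N + 1))
    (u w : Finset.Icc (-(ℓ : ℤ)) (ℓ : ℤ)) :
    swapDefect p (x + ((u : ℤ) : ZMod (2 * N + 1))) (x + ((w : ℤ) : ZMod (2 * N + 1))) ≤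
      2 * ∑ k ∈ Finset.range (2 * ℓ), swapDefect p (x - ℓ + k) (x - ℓ + k + 1) := by
  have hinj : Set.InjOn (fun k : ℕ => x - ℓ + (k : ZMod (2 * N + 1))) (Set.Iic (2 * ℓ)) := by
    intro i hi j hj h
    rw [Set.mem_Iic] at hi hj
    have := @injective_add_intCast ℓ N hℓ x ⟨(i : ℤ) - ℓ, by rw [Finset.mem_Icc]; omega⟩
      ⟨(j : ℤ) - ℓ, by rw [Finset.mem_Icc]; omega⟩ (by
        push_cast
        simp only at h
        linear_combination h)
    have := congrArg Subtype.val this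
    simp only at this
    omega
  have hu := Finset.mem_Icc.1 u.2
  have hw := Finset.mem_Icc.1 w.2
  have hcast : ∀ v : Finset.Icc (-(ℓ : ℤ)) (ℓ : ℤ), x + ((v : ℤ) : ZMod (2 * N + 1)) =
      x - ℓ + (((v : ℤ) + ℓ).toNat : ZMod (2 * N + 1)) := fun v => by
    have hv := Finset.mem_Icc.1 v.2
    have : (((v : ℤ) + ℓ).toNat : ZMod (2 * N + 1)) = (((v : ℤ) + ℓ : ℤ) : ZMod (2 * N + 1)) := by
      rw [← Int.cast_natCast, Int.toNat_of_nonneg (by omega)]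
    rw [this]
    push_cast
    ring
  rw [hcast u, hcast w]
  refine (swapDefect_path_le p hinj (by omega) (by omega)).trans (le_of_eq ?_)
  congr 1
  refine Finset.sum_congr rfl fun k _ => ?_
  congr 1
  push_cast
  ring

theorem sum_swapDefect_block (p : Config N → ℝ) :
    ∑ x : ZMod (2 * N + 1), 2 * ∑ k ∈ Finset.range (2 * ℓ),
      swapDefect p (x - ℓ + k) (x - ℓ + k + 1) =
      4 * ℓ * ∑ z : ZMod (2 * N + 1), swapDefect p z (z + 1) := by
  rw [← Finset.mul_sum, Finset.sum_comm]
  have : ∀ k : ℕ, ∑ x : ZMod (2 * N + 1), swapDefect p (x - ℓ + k) (x - ℓ + k + 1) =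
      ∑ z : ZMod (2 * N + 1), swapDefect p z (z + 1) := fun k => by
    refine Eq.trans (Finset.sum_congr rfl fun x _ => ?_)
      (Equiv.sum_comp (Equiv.addRight ((k : ZMod (2 * N + 1)) - ℓ)) fun z => swapDefect p z (z + 1))
    rw [Equiv.coe_addRight]
    congr 1 <;> ring
  simp only [this]
  simp
  ring

end Block

/-! ### Markov chains and the forward equation -/

section Chain

variable {S Ω : Type*} [Fintype S] [DecidableEq S] [MeasurableSpace S] [MeasurableSpace Ω]
  {Q : Matrix S S ℝ} {ν : Measure S} {P : Measure Ω} {X : ℝ → Ω → S}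

/-- The law at time `t` of the chain with generator `Q` and initial law `ν`. -/
noncomputable def chainLaw (Q : Matrix S S ℝ) (ν : Measure S) (t : ℝ) (σ : S) : ℝ :=
  ∑ a, ν.real {a} * NormedSpace.exp (t • Q) a σ

theorem hasDerivAt_chainLaw (Q : Matrix S S ℝ) (ν : Measure S) (t : ℝ) (σ : S) :
    HasDerivAt (fun t => chainLaw Q ν t σ) (∑ τ, chainLaw Q ν t τ * Q τ σ) t := by
  -- any algebra norm will do: the exponential depends on the topology only
  let _ : NormedRing (Matrix S S ℝ) := Matrix.linftyOpNormedRing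
  let _ : NormedAlgebra ℝ (Matrix S S ℝ) := Matrix.linftyOpNormedAlgebra
  have h := hasDerivAt_exp_smul_const (𝕂 := ℝ) Q t
  have h1 : ∀ a, HasDerivAt (fun t => NormedSpace.exp (t • Q) a σ)
      ((NormedSpace.exp (t • Q) * Q) a σ) t := fun a => by
    have := (LinearMap.toContinuousLinearMap
      (Matrix.entryLinearMap ℝ ℝ a σ)).hasFDerivAt.comp_hasDerivAt t h
    exact this
  have h2 := HasDerivAt.fun_sum fun a (_ : a ∈ Finset.univ) => (h1 a).const_mul (ν.real {a})
  refine h2.congr_deriv ?_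
  simp only [chainLaw, Finset.sum_mul, Matrix.mul_apply, Finset.mul_sum]
  rw [Finset.sum_comm]
  exact Finset.sum_congr rfl fun _ _ => Finset.sum_congr rfl fun _ _ => by ring

theorem continuous_chainLaw (Q : Matrix S S ℝ) (ν : Measure S) (σ : S) :
    Continuous fun t => chainLaw Q ν t σ :=
  continuous_iff_continuousAt.2 fun t => (hasDerivAt_chainLaw Q ν t σ).continuousAt

variable [MeasurableSingletonClass S]

theorem IsMarkovChain.measureReal_eq (h : IsMarkovChain Q ν P X) {t : ℝ} (ht : 0 ≤ t) (σ : S) :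
    P.real (X t ⁻¹' {σ}) = chainLaw Q ν t σ := by
  have := h.isProbabilityMeasure
  have h1 : ∀ a, P.real (X 0 ⁻¹' {a} ∩ X t ⁻¹' {σ}) =
      ν.real {a} * NormedSpace.exp (t • Q) a σ := fun a => by
    have h2 := h.finite_dimensional 1 (fun k => if k = 0 then 0 else t)
      (fun k => if k = 0 then a else σ) rfl (by
        intro i j hij
        by_cases hi : i = 0
        · by_cases hj : j = 0 <;> simp [hi, hj, ht]
        · have hj : j ≠ 0 := by omega
          simp [hi, hj])
    simp only [Finset.range_one, Finset.prod_singleton, if_true, zero_add, one_ne_zero, if_false,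
      sub_zero] at h2
    rw [← h2]
    congr 1
    ext w
    simp only [Set.mem_inter_iff, Set.mem_preimage, Set.mem_singleton_iff, Set.mem_ofPred_eq]
    constructor
    · rintro ⟨h3, h4⟩ i hi
      interval_cases i <;> simp [h3, h4]
    · intro h3
      exact ⟨by simpa using h3 0 (by norm_num), by simpa using h3 1 le_rfl⟩
  unfold chainLaw
  simp only [← h1]
  rw [← measureReal_biUnion_finset]
  · congr 1
    ext w
    simp
  · intro a _ b _ hab
    refine Set.disjoint_left.2 fun w hw hw' => hab ?_
    exact hw.1.symm.trans hw'.1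
  · intro a _
    exact (h.measurable 0 le_rfl (measurableSet_singleton a)).inter
      (h.measurable t ht (measurableSet_singleton σ))

theorem IsMarkovChain.chainLaw_nonneg (h : IsMarkovChain Q ν P X) {t : ℝ} (ht : 0 ≤ t) (σ : S) :
    0 ≤ chainLaw Q ν t σ := by
  rw [← h.measureReal_eq ht]
  exact measureReal_nonneg

theorem IsMarkovChain.sum_chainLaw (h : IsMarkovChain Q ν P X) {t : ℝ} (ht : 0 ≤ t) :
    ∑ σ, chainLaw Q ν t σ = 1 := by
  have := h.isProbabilityMeasure
  simp only [← h.measureReal_eq ht]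
  rw [← measureReal_biUnion_finset]
  · have : ⋃ b ∈ Finset.univ, X t ⁻¹' {b} = Set.univ := by ext w; simp
    rw [this, probReal_univ]
  · intro a _ b _ hab
    exact Set.disjoint_left.2 fun w hw hw' => hab (hw.symm.trans hw')
  · intro a _
    exact h.measurable t ht (measurableSet_singleton a)

/-- A right-continuous process is jointly measurable: it is the limit of its values at the next
point of the grid of mesh `1 / (n + 1)`. -/
theorem IsMarkovChain.measurable_uncurry (h : IsMarkovChain Q ν P X) (f : S → ℝ) :
    Measurable fun z : ℝ × Ω => f (X (max z.1 0) z.2) := by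
  set g : ℕ → ℝ → ℝ := fun n t => (⌊t * (n + 1)⌋₊ + 1) / (n + 1) with hg
  have hf : Measurable f := measurable_of_finite f
  refine measurable_of_tendsto_metrizable (f := fun n z => f (X (g n z.1) z.2)) (fun n => ?_) ?_
  · have h1 : Measurable fun z : ℕ × Ω => f (X ((z.1 + 1) / (n + 1)) z.2) :=
      measurable_from_prod_countable_right fun k => by
        have hk : (0 : ℝ) ≤ ((k : ℝ) + 1) / (n + 1) := by positivity
        exact hf.comp (h.measurable _ hk)
    have h2 : Measurable fun z : ℝ × Ω => ((⌊z.1 * (n + 1)⌋₊, z.2) : ℕ × Ω) :=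
      (Nat.measurable_floor.comp (measurable_fst.mul_const _)).prodMk measurable_snd
    exact h1.comp h2
  · rw [tendsto_pi_nhds]
    rintro ⟨t, w⟩
    have hgt : Tendsto (fun n => g n t) atTop (𝓝[>] (max t 0)) := by
      have hfl : ∀ n : ℕ, (⌊t * ((n : ℝ) + 1)⌋₊ : ℝ) = ⌊max t 0 * ((n : ℝ) + 1)⌋₊ := fun n => by
        rcases le_total t 0 with ht | ht
        · rw [max_eq_right ht, Nat.floor_of_nonpos (mul_nonpos_of_nonpos_of_nonneg ht
            (by positivity))]
          simp
        · rw [max_eq_left ht]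
      have hlt : ∀ n, max t 0 < g n t := fun n => by
        have h1 := Nat.lt_floor_add_one (max t 0 * ((n : ℝ) + 1))
        rw [hg]
        simp only
        rw [lt_div_iff₀ (by positivity), hfl]
        exact h1
      refine tendsto_nhdsWithin_iff.2 ⟨?_, Eventually.of_forall hlt⟩
      have hup : ∀ n, g n t ≤ max t 0 + 1 / ((n : ℝ) + 1) := fun n => by
        have h1 := Nat.floor_le (a := max t 0 * ((n : ℝ) + 1)) (by positivity)
        rw [hg]
        simp only
        rw [hfl, add_div]
        gcongr
        rwa [div_le_iff₀ (by positivity)]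
      refine tendsto_of_tendsto_of_tendsto_of_le_of_le tendsto_const_nhds ?_
        (fun n => (hlt n).le) hup
      simpa using tendsto_const_nhds.add (tendsto_one_div_add_atTop_nhds_zero_nat (𝕜 := ℝ))
    have := hgt.eventually (h.right_continuous w (max t 0) (le_max_right _ _))
    exact tendsto_const_nhds.congr' (this.mono fun n hn => by simp only [hn])

/-- The expected absolute value of a time integral along the chain is at most the time integral of
the expected absolute value. -/
theorem IsMarkovChain.lintegral_abs_integral_le (h : IsMarkovChain Q ν P X) (f : S → ℝ)
    {T : ℝ} (hT : 0 ≤ T) :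
    ∫⁻ w, ENNReal.ofReal |∫ t in (0 : ℝ)..T, f (X t w)| ∂P ≤
      ENNReal.ofReal (∫ t in (0 : ℝ)..T, ∑ σ, chainLaw Q ν t σ * |f σ|) := by
  have := h.isProbabilityMeasure
  have hmeas := (h.measurable_uncurry f).norm.ennreal_ofReal
  have hinner : ∀ t ∈ Set.Ioc 0 T, ∫⁻ w, ENNReal.ofReal ‖f (X (max t 0) w)‖ ∂P =
      ENNReal.ofReal (∑ σ, chainLaw Q ν t σ * |f σ|) := by
    intro t ht
    rw [max_eq_left ht.1.le]
    have hX := h.measurable t ht.1.le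
    have h1 : ∫⁻ w, ENNReal.ofReal ‖f (X t w)‖ ∂P =
        ∫⁻ σ, ENNReal.ofReal |f σ| ∂(P.map (X t)) :=
      (lintegral_map (f := fun σ => ENNReal.ofReal |f σ|) (measurable_of_finite _) hX).symm
    rw [h1, lintegral_fintype, ENNReal.ofReal_sum_of_nonneg
      fun σ _ => mul_nonneg (h.chainLaw_nonneg ht.1.le σ) (abs_nonneg _)]
    refine Finset.sum_congr rfl fun σ _ => ?_
    rw [Measure.map_apply hX (measurableSet_singleton σ),
      ENNReal.ofReal_mul (h.chainLaw_nonneg ht.1.le σ), ← h.measureReal_eq ht.1.le,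
      ofReal_measureReal, mul_comm]
  have hcont : Continuous fun t => ∑ σ, chainLaw Q ν t σ * |f σ| :=
    continuous_finsetSum _ fun σ _ => (continuous_chainLaw Q ν σ).mul continuous_const
  calc ∫⁻ w, ENNReal.ofReal |∫ t in (0 : ℝ)..T, f (X t w)| ∂P
      ≤ ∫⁻ w, (∫⁻ t in Set.Ioc 0 T, ENNReal.ofReal ‖f (X (max t 0) w)‖) ∂P := by
        refine lintegral_mono fun w => ?_
        rw [intervalIntegral.integral_of_le hT]
        have h1 : ∫ t in Set.Ioc 0 T, f (X t w) = ∫ t in Set.Ioc 0 T, f (X (max t 0) w) :=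
          setIntegral_congr_fun measurableSet_Ioc fun t ht => by
            simp only [max_eq_left ht.1.le]
        rw [h1, ← Real.norm_eq_abs, ofReal_norm]
        simp only [ofReal_norm]
        exact enorm_integral_le_lintegral_enorm _
    _ = ∫⁻ t in Set.Ioc 0 T, ∫⁻ w, ENNReal.ofReal ‖f (X (max t 0) w)‖ ∂P := by
        refine lintegral_lintegral_swap ?_
        exact (hmeas.comp measurable_swap).aemeasurable
    _ = ∫⁻ t in Set.Ioc 0 T, ENNReal.ofReal (∑ σ, chainLaw Q ν t σ * |f σ|) :=
        setLIntegral_congr_fun measurableSet_Ioc hinner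
    _ = _ := by
        rw [intervalIntegral.integral_of_le hT]
        refine (ofReal_integral_eq_lintegral_ofReal ?_ ?_).symm
        · exact (hcont.integrableOn_Icc (a := 0) (b := T)).mono_set Set.Ioc_subset_Icc_self
        · refine (ae_restrict_iff' measurableSet_Ioc).2 (Eventually.of_forall fun t ht => ?_)
          exact Finset.sum_nonneg fun σ _ =>
            mul_nonneg (h.chainLaw_nonneg ht.1.le σ) (abs_nonneg _)

end Chain

section Kawasaki

variable {K : ℝ → ℝ} {γ β : ℝ} {N : ℕ}

theorem exchange_involutive (i : ZMod (2 * N + 1)) :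
    Function.Involutive fun σ : Config N => exchange σ i :=
  fun σ => comp_swap_comp_swap σ i (i + 1)

theorem rate_eq_heatBath (σ : Config N) (i : ZMod (2 * N + 1)) :
    rate K γ β σ i =
      heatBath (β * hamiltonian K γ N (exchange σ i) - β * hamiltonian K γ N σ) := by
  rw [rate, heatBath, mul_sub]

/-- The forward equation of the Kawasaki dynamics, in the form gain minus loss on each bond. -/
theorem sum_mul_generator (p : Config N → ℝ) (σ : Config N) :
    ∑ τ, p τ * generator K γ β N τ σ =
      ∑ i, (p (exchange σ i) * rate K γ β (exchange σ i) i - p σ * rate K γ β σ i) := by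
  unfold generator
  simp only [Finset.mul_sum]
  rw [Finset.sum_comm]
  refine Finset.sum_congr rfl fun i _ => ?_
  have h1 : ∀ τ : Config N, (if exchange τ i = σ then (1 : ℝ) else 0) =
      if τ = exchange σ i then 1 else 0 := fun τ => by
    congr 1
    exact propext ((exchange_involutive i).eq_iff)
  simp only [h1, mul_sub, Finset.sum_sub_distrib]
  simp

end Kawasaki

/-! ### The one-block error at fixed parameters -/

section Shift

variable {N : ℕ} {J : ℝ → ℝ} {L Jm : ℝ}

theorem valMinAbs_div_mem_Icc (hN : 1 ≤ N) (x : ZMod (2 * N + 1)) :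
    (x.valMinAbs : ℝ) / N ∈ Set.Icc (-1 : ℝ) 1 := by
  have h := ZMod.valMinAbs_mem_Ioc x
  rw [Set.mem_Ioc] at h
  push_cast at h
  have hN0 : (0 : ℝ) < N := by exact_mod_cast hN
  have h1 : -(N : ℝ) ≤ x.valMinAbs := by
    have : -(N : ℤ) ≤ x.valMinAbs := by omega
    exact_mod_cast this
  have h2 : (x.valMinAbs : ℝ) ≤ N := by
    have : x.valMinAbs ≤ (N : ℤ) := by omega
    exact_mod_cast this
  rw [Set.mem_Icc, le_div_iff₀ hN0, div_le_iff₀ hN0]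
  constructor <;> linarith

/-- The variation of a sampled test function around the circle is bounded; the jump at the point
opposite to the origin is there because the test function need not be periodic. -/
theorem sum_abs_sample_add_one_sub_le (hN : 1 ≤ N)
    (hL : ∀ a ∈ Set.Icc (-1 : ℝ) 1, ∀ b ∈ Set.Icc (-1 : ℝ) 1, |J a - J b| ≤ L * |a - b|) :
    ∑ x : ZMod (2 * N + 1), |J (((x + 1).valMinAbs : ℝ) / N) - J ((x.valMinAbs : ℝ) / N)| ≤
      4 * L := by
  have hN0 : (0 : ℝ) < N := by exact_mod_cast hN
  have := sum_abs_valMinAbs_add_one_sub (N := N) fun w => J ((w : ℝ) / N)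
  rw [this]
  have hmem : ∀ k : ℕ, k ≤ 2 * N → (((k : ℤ) - N : ℤ) : ℝ) / N ∈ Set.Icc (-1 : ℝ) 1 := by
    intro k hk
    have hk' : (k : ℝ) ≤ 2 * N := by exact_mod_cast hk
    have hk0 : (0 : ℝ) ≤ k := Nat.cast_nonneg _
    push_cast
    rw [Set.mem_Icc, le_div_iff₀ hN0, div_le_iff₀ hN0]
    constructor <;> linarith
  have h1 : ∑ k ∈ Finset.range (2 * N), |J (((((k + 1 : ℕ) : ℤ) - N : ℤ) : ℝ) / N) -
      J ((((k : ℤ) - N : ℤ) : ℝ) / N)| ≤ ∑ _k ∈ Finset.range (2 * N), L / N := by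
    refine Finset.sum_le_sum fun k hk => ?_
    rw [Finset.mem_range] at hk
    refine (hL _ (hmem _ (by omega)) _ (hmem _ hk.le)).trans (le_of_eq ?_)
    have : ((((k + 1 : ℕ) : ℤ) - N : ℤ) : ℝ) / N - (((k : ℤ) - N : ℤ) : ℝ) / N = 1 / N := by
      push_cast; ring
    rw [this, abs_of_pos (by positivity)]
    ring
  have h2 : |J (((-(N : ℤ) : ℤ) : ℝ) / N) - J (((N : ℤ) : ℝ) / N)| ≤ 2 * L := by
    have e1 : ((-(N : ℤ) : ℤ) : ℝ) / N = -1 := by push_cast; field_simp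
    have e2 : ((N : ℤ) : ℝ) / N = 1 := by push_cast; field_simp
    rw [e1, e2]
    refine (hL _ (by norm_num) _ (by norm_num)).trans (le_of_eq ?_)
    norm_num; ring
  rw [Finset.sum_const, Finset.card_range, nsmul_eq_mul] at h1
  have h3 : ((2 * N : ℕ) : ℝ) * (L / N) = 2 * L := by push_cast; field_simp
  linarith

theorem sum_abs_shift_sub_le {R : Type*} [AddCommGroupWithOne R] [Fintype R] (F : R → ℝ) (y : ℕ) :
    ∑ x, |F (x + y) - F x| ≤ y * ∑ x, |F (x + 1) - F x| := by
  induction y with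
  | zero => simp
  | succ y ih =>
    have h1 : ∑ x, |F (x + (y + 1 : ℕ)) - F x| ≤
        ∑ x, (|F (x + y + 1) - F (x + y)| + |F (x + y) - F x|) := by
      refine Finset.sum_le_sum fun x _ => ?_
      rw [Nat.cast_succ, ← add_assoc]
      exact abs_sub_le _ _ _
    have h2 : ∑ x, |F (x + y + 1) - F (x + y)| = ∑ x, |F (x + 1) - F x| :=
      Equiv.sum_comp (Equiv.addRight (y : R)) fun x => |F (x + 1) - F x|
    rw [Finset.sum_add_distrib, h2] at h1
    push_cast at h1 ⊢
    linarith

/-- Averaging an observable over `q` consecutive translates inside a weighted sum over the circle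
costs at most `q` times the variation of the weight. -/
theorem abs_sum_mul_sub_average_le {R : Type*} [AddCommGroupWithOne R] [Fintype R] (F G : R → ℝ)
    {B V : ℝ} (hG : ∀ x, |G x| ≤ B) (hV : ∑ x, |F (x + 1) - F x| ≤ V) {q : ℕ} (hq : 0 < q) :
    |∑ x, F x * G x - ∑ x, F x * ((∑ y ∈ Finset.range q, G (x + y)) / q)| ≤ q * (B * V) := by
  have hq0 : (0 : ℝ) < q := by exact_mod_cast hq
  have hB : 0 ≤ B := (abs_nonneg _).trans (hG 0)
  have hV0 : 0 ≤ V := (Finset.sum_nonneg fun _ _ => abs_nonneg _).trans hV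
  have h1 : ∀ y ∈ Finset.range q,
      |∑ x, (F (x + y) - F x) * G (x + y)| ≤ q * (B * V) := by
    intro y hy
    have hy' : (y : ℝ) ≤ q := by exact_mod_cast (Finset.mem_range.1 hy).le
    calc |∑ x, (F (x + y) - F x) * G (x + y)| ≤ ∑ x, |F (x + y) - F x| * B := by
          refine (Finset.abs_sum_le_sum_abs _ _).trans (Finset.sum_le_sum fun x _ => ?_)
          rw [abs_mul]
          exact mul_le_mul_of_nonneg_left (hG _) (abs_nonneg _)
      _ = B * ∑ x, |F (x + y) - F x| := by rw [← Finset.sum_mul, mul_comm]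
      _ ≤ B * (q * V) := by
          refine mul_le_mul_of_nonneg_left ((sum_abs_shift_sub_le F y).trans ?_) hB
          exact mul_le_mul hy' hV (Finset.sum_nonneg fun _ _ => abs_nonneg _) hq0.le
      _ = _ := by ring
  have h2 : q * (∑ x, F x * G x - ∑ x, F x * ((∑ y ∈ Finset.range q, G (x + y)) / q)) =
      ∑ y ∈ Finset.range q, ∑ x, (F (x + y) - F x) * G (x + y) := by
    have e1 : ∀ y : ℕ, ∑ x, F (x + y) * G (x + y) = ∑ x, F x * G x := fun y =>
      Equiv.sum_comp (Equiv.addRight (y : R)) fun x => F x * G x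
    simp only [sub_mul, Finset.sum_sub_distrib, e1]
    rw [Finset.sum_const, Finset.card_range, nsmul_eq_mul, mul_sub, Finset.sum_comm]
    congr 1
    rw [Finset.mul_sum]
    refine Finset.sum_congr rfl fun x _ => ?_
    rw [← Finset.mul_sum]
    field_simp
  have h3 : (q : ℝ) * |∑ x, F x * G x - ∑ x, F x * ((∑ y ∈ Finset.range q, G (x + y)) / q)| ≤
      q * (q * (B * V)) := by
    rw [← abs_of_pos hq0, ← abs_mul, abs_of_pos hq0, h2]
    refine (Finset.abs_sum_le_sum_abs _ _).trans ((Finset.sum_le_sum h1).trans (le_of_eq ?_))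
    simp
  exact le_of_mul_le_mul_left h3 hq0

end Shift

section Main

variable {K : ℝ → ℝ} {γ β κ : ℝ} {N r ℓ : ℕ} {Ψ : (ℤ → ℤˣ) → ℝ} {c : Finset ℤ → ℝ} {J : ℝ → ℝ}
  {L Jm T θ : ℝ} {Ω : Type*} [MeasurableSpace Ω] {ν : Measure (Config N)} {P : Measure Ω}
  {X : ℝ → Ω → Config N}

/-- On the diffusive time scale the law of the dynamics is nearly invariant under neighbour
exchanges: on average over bonds and over time, the defect is of order `γ + N⁻¹`. -/
theorem integral_sum_swapDefect_le (hK : IsKacProfile K) (hγ : 0 ≤ γ) (hN : 1 ≤ N)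
    (hκ : ∑ z : ZMod (2 * N + 1),
      |kacKernel K γ N (z + 1).valMinAbs - kacKernel K γ N z.valMinAbs| ≤ κ * γ)
    (hκ0 : 0 ≤ κ) (h : IsMarkovChain ((N : ℝ) ^ 2 • generator K γ β N) ν P X) (hT : 0 ≤ T) :
    ∫ t in (0 : ℝ)..T, ∑ z, swapDefect
      (chainLaw ((N : ℝ) ^ 2 • generator K γ β N) ν t) z (z + 1) ≤
      (24 * T + 12 * |β| + 8 + 36 * |β| * κ * T) * (1 + γ * N) := by
  set p := chainLaw ((N : ℝ) ^ 2 • generator K γ β N) ν with hp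
  have hN0 : (1 : ℝ) ≤ N := by exact_mod_cast hN
  have hder : ∀ t σ, HasDerivAt (fun t => p t σ) ((N : ℝ) ^ 2 * ∑ i, (p t (exchange σ i) *
      heatBath (β * hamiltonian K γ N σ - β * hamiltonian K γ N (exchange σ i)) -
      p t σ * heatBath (β * hamiltonian K γ N (exchange σ i) - β * hamiltonian K γ N σ))) t := by
    intro t σ
    refine (hasDerivAt_chainLaw _ ν t σ).congr_deriv ?_
    have e1 : ∀ i, rate K γ β (exchange σ i) i =
        heatBath (β * hamiltonian K γ N σ - β * hamiltonian K γ N (exchange σ i)) := fun i => by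
      have e2 : exchange (exchange σ i) i = σ := exchange_involutive i σ
      rw [rate_eq_heatBath, e2]
    simp only [← e1, ← rate_eq_heatBath, ← sum_mul_generator]
    rw [Finset.mul_sum]
    refine Finset.sum_congr rfl fun τ _ => ?_
    rw [Matrix.smul_apply, smul_eq_mul]
    ring
  have hB : ∀ σ, |β * hamiltonian K γ N σ| ≤ |β| * (2 * N + 1) := fun σ => by
    rw [abs_mul]
    exact mul_le_mul_of_nonneg_left (hK.abs_hamiltonian_le hγ σ) (abs_nonneg _)
  have hΔ : ∀ (i : ZMod (2 * N + 1)) σ, |β * hamiltonian K γ N (exchange σ i) -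
      β * hamiltonian K γ N σ| ≤ |β| * (2 * (κ * γ)) := fun i σ => by
    rw [← mul_sub, abs_mul]
    refine mul_le_mul_of_nonneg_left ((abs_hamiltonian_exchange_sub_le σ i).trans ?_) (abs_nonneg _)
    linarith
  have hmain := integral_sum_abs_sub_le (s := fun i (σ : Config N) => exchange σ i)
    (E := fun σ => β * hamiltonian K γ N σ) exchange_involutive hB hΔ
    (by linarith : (0 : ℝ) < N) hder (fun t ht => h.chainLaw_nonneg ht)
    (fun t ht => h.sum_chainLaw ht) hT
  have hcardI : (Fintype.card (ZMod (2 * N + 1)) : ℝ) = 2 * N + 1 := by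
    rw [ZMod.card]; push_cast; ring
  have hcardC : Real.log (Fintype.card (Config N)) = (2 * N + 1) * Real.log 2 := by
    rw [Fintype.card_fun, ZMod.card, Fintype.card_units_int]
    push_cast
    rw [Real.log_pow]
    push_cast
    ring
  rw [hcardI, hcardC] at hmain
  refine hmain.trans ?_
  have hlog : Real.log 2 ≤ 1 := by
    have := Real.log_two_lt_d9; linarith
  have hb := abs_nonneg β
  have h1 : 4 * (2 * (N : ℝ) + 1) * T + (Real.log 2 + 2 * (|β| * (2 * N + 1)) +
      (2 * N + 1) * Real.log 2) ≤ N * (12 * T + 6 * |β| + 4) := by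
    have : (2 * (N : ℝ) + 1) * T ≤ 3 * N * T := by nlinarith
    have : |β| * (2 * N + 1) ≤ |β| * (3 * N) := by nlinarith
    have : (2 * (N : ℝ) + 1) * Real.log 2 ≤ 3 * N * 1 :=
      mul_le_mul (by linarith) hlog (Real.log_nonneg (by norm_num)) (by linarith)
    nlinarith
  have h2 : 2 / (N : ℝ) * (4 * (2 * (N : ℝ) + 1) * T + (Real.log 2 + 2 * (|β| * (2 * N + 1)) +
      (2 * N + 1) * Real.log 2)) ≤ 24 * T + 12 * |β| + 8 := by
    calc _ ≤ 2 / (N : ℝ) * (N * (12 * T + 6 * |β| + 4)) :=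
          mul_le_mul_of_nonneg_left h1 (by positivity)
      _ = _ := by field_simp; ring
  have h3 : 6 * (|β| * (2 * (κ * γ))) * (2 * N + 1) * T ≤ 36 * |β| * κ * T * (γ * N) := by
    have h4 : 0 ≤ |β| * κ * γ * T := by positivity
    nlinarith
  have h5 : 0 ≤ (24 * T + 12 * |β| + 8) * (γ * N) := by positivity
  have h6 : 0 ≤ 36 * |β| * κ * T := by positivity
  linarith

theorem abs_observable_le
    (hc : ∀ σ, Ψ σ = ∑ A ∈ (Finset.Icc (-(r : ℤ)) r).powerset, c A * ∏ i ∈ A, spin (σ i))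
    (σ : ℤ → ℤˣ) : |Ψ σ| ≤ coeffSize r c := by
  rw [hc]
  refine (Finset.abs_sum_le_sum_abs _ _).trans (Finset.sum_le_sum fun A _ => ?_)
  rw [abs_mul, abs_prod_spin]
  refine mul_le_mul_of_nonneg_left ?_ (abs_nonneg _)
  have : (0 : ℝ) ≤ A.card := Nat.cast_nonneg _
  nlinarith

/-- Deterministic part of the estimate: the spatial average is controlled by the distance of the
block averages of the observable to the product mean at the block magnetization. -/
theorem abs_oneBlockAverage_le (hK : IsKacProfile K) (hγ : 0 ≤ γ) (hN : 1 ≤ N)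
    (hκ : ∀ z, kacKernel K γ N z ≤ κ) (hr : r ≤ ℓ)
    (hc : ∀ σ, Ψ σ = ∑ A ∈ (Finset.Icc (-(r : ℤ)) r).powerset, c A * ∏ i ∈ A, spin (σ i))
    (hL : ∀ a ∈ Set.Icc (-1 : ℝ) 1, ∀ b ∈ Set.Icc (-1 : ℝ) 1, |J a - J b| ≤ L * |a - b|)
    (hJ : ∀ a ∈ Set.Icc (-1 : ℝ) 1, |J a| ≤ Jm) (σ : Config N) :
    |oneBlockAverage K γ β N Ψ J ℓ σ| ≤
      1 / N * ((ℓ - r + 1 : ℕ) * (coeffSize r c * (4 * L)) +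
        ∑ x : ZMod (2 * N + 1), Jm *
          (|(∑ y ∈ Finset.range (ℓ - r + 1), Ψ (shiftConfig (x + (y : ZMod (2 * N + 1))) σ)) /
              (ℓ - r + 1 : ℕ) - meanPolynomial r c (blockAverage ℓ x σ)| +
            coeffSize r c *
              (Real.exp (|β| * (2 * ((2 * ℓ + 1) * κ))) - 1 + 1 / (2 * ℓ + 1)))) := by
  have hN0 : (0 : ℝ) < N := by exact_mod_cast hN
  set q := ℓ - r + 1 with hq
  set F : ZMod (2 * N + 1) → ℝ := fun x => J ((x.valMinAbs : ℝ) / N) with hF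
  set G : ZMod (2 * N + 1) → ℝ := fun x => Ψ (shiftConfig x σ) with hG
  have h1 := abs_sum_mul_sub_average_le F G (fun x => abs_observable_le hc _)
    (sum_abs_sample_add_one_sub_le hN hL) (q := q) (by omega)
  unfold oneBlockAverage
  rw [abs_mul, abs_of_pos (by positivity : (0 : ℝ) < 1 / N)]
  refine mul_le_mul_of_nonneg_left ?_ (by positivity)
  have h2 : ∑ x : ZMod (2 * N + 1), J ((x.valMinAbs : ℝ) / N) *
      (Ψ (shiftConfig x σ) - canonicalMean K γ β N Ψ ℓ (blockAverage ℓ x σ)) =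
      (∑ x, F x * G x - ∑ x, F x * ((∑ y ∈ Finset.range q, G (x + y)) / q)) +
      ∑ x, F x * ((∑ y ∈ Finset.range q, G (x + y)) / q -
        canonicalMean K γ β N Ψ ℓ (blockAverage ℓ x σ)) := by
    simp only [mul_sub, Finset.sum_sub_distrib, hF, hG]
    ring
  rw [h2]
  refine (abs_add_le _ _).trans (add_le_add h1 ?_)
  refine (Finset.abs_sum_le_sum_abs _ _).trans (Finset.sum_le_sum fun x _ => ?_)
  rw [abs_mul]
  refine mul_le_mul (hJ _ (valMinAbs_div_mem_Icc hN x)) ?_ (abs_nonneg _)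
    ((abs_nonneg _).trans (hJ 0 (by norm_num)))
  refine (abs_sub_le _ (meanPolynomial r c (blockAverage ℓ x σ)) _).trans
    (add_le_add_right ?_ _)
  rw [abs_sub_comm]
  exact abs_canonicalMean_sub_le hK hγ hκ hr hc (blockSector_blockAverage_nonempty x σ)

/-- The one-block error at fixed `N`, `γ` and `ℓ`, with a free parameter `θ`. -/
theorem oneBlockError_le (hK : IsKacProfile K) (hγ : 0 ≤ γ) (hN : 1 ≤ N)
    (hκ0 : 0 ≤ κ) (hκ1 : ∀ z, kacKernel K γ N z ≤ κ * γ)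
    (hκ2 : ∑ z : ZMod (2 * N + 1),
      |kacKernel K γ N (z + 1).valMinAbs - kacKernel K γ N z.valMinAbs| ≤ κ * γ)
    (hr : r ≤ ℓ) (hℓ : ℓ ≤ N)
    (hc : ∀ σ, Ψ σ = ∑ A ∈ (Finset.Icc (-(r : ℤ)) r).powerset, c A * ∏ i ∈ A, spin (σ i))
    (hL : ∀ a ∈ Set.Icc (-1 : ℝ) 1, ∀ b ∈ Set.Icc (-1 : ℝ) 1, |J a - J b| ≤ L * |a - b|)
    (hJ : ∀ a ∈ Set.Icc (-1 : ℝ) 1, |J a| ≤ Jm) (hT : 0 ≤ T) (hθ : 0 < θ)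
    (h : IsMarkovChain ((N : ℝ) ^ 2 • generator K γ β N) ν P X) :
    oneBlockError K γ β N Ψ J T P X ℓ ≤ ENNReal.ofReal
      (T * (1 / N * ((ℓ - r + 1 : ℕ) * (coeffSize r c * (4 * L)))) +
        T * (3 * Jm * coeffSize r c * (θ + 1 / (ℓ - r + 1 : ℕ) / θ +
          (Real.exp (|β| * (2 * ((2 * ℓ + 1) * (κ * γ)))) - 1 + 1 / (2 * ℓ + 1)))) +
        1 / N * (Jm * coeffSize r c / θ * (4 * ℓ *
          ((24 * T + 12 * |β| + 8 + 36 * |β| * κ * T) * (1 + γ * N))))) := by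
  have hN0 : (1 : ℝ) ≤ N := by exact_mod_cast hN
  have hJm : 0 ≤ Jm := (abs_nonneg _).trans (hJ 0 (by norm_num))
  refine (h.lintegral_abs_integral_le _ hT).trans (ENNReal.ofReal_le_ofReal ?_)
  set p := chainLaw ((N : ℝ) ^ 2 • generator K γ β N) ν with hp
  have hdef := integral_sum_swapDefect_le hK hγ hN hκ2 hκ0 h hT
  rw [← hp] at hdef
  set C₁ := 24 * T + 12 * |β| + 8 + 36 * |β| * κ * T
  set q := ℓ - r + 1 with hq
  set S := coeffSize r c with hS
  have hS0 : 0 ≤ S := coeffSize_nonneg r c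
  set δ : ℝ := Real.exp (|β| * (2 * ((2 * ℓ + 1) * (κ * γ)))) - 1 + 1 / (2 * ℓ + 1) with hδ
  have hδ0 : 0 ≤ δ := by
    have h1 := Real.add_one_le_exp (|β| * (2 * ((2 * (ℓ : ℝ) + 1) * (κ * γ))))
    have h2 : 0 ≤ |β| * (2 * ((2 * (ℓ : ℝ) + 1) * (κ * γ))) := by positivity
    have h3 : (0 : ℝ) ≤ 1 / (2 * ℓ + 1) := by positivity
    rw [hδ]
    linarith
  have hpt : ∀ t ∈ Set.Icc 0 T, ∑ σ, p t σ * |oneBlockAverage K γ β N Ψ J ℓ σ| ≤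
      1 / N * (q * (S * (4 * L))) + 3 * Jm * S * (θ + 1 / q / θ + δ) +
        1 / N * (Jm * S / θ * (4 * ℓ)) * ∑ z, swapDefect (p t) z (z + 1) := by
    intro t ht
    have hp0 := h.chainLaw_nonneg ht.1
    have hp1 := h.sum_chainLaw ht.1
    rw [← hp] at hp0 hp1
    set D : ZMod (2 * N + 1) → ℝ := fun x =>
      2 * ∑ k ∈ Finset.range (2 * ℓ), swapDefect (p t) (x - ℓ + k) (x - ℓ + k + 1) with hD
    set Y : ZMod (2 * N + 1) → Config N → ℝ := fun x σ =>
      |(∑ y ∈ Finset.range q, Ψ (shiftConfig (x + (y : ZMod (2 * N + 1))) σ)) / q -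
        meanPolynomial r c (blockAverage ℓ x σ)| with hY
    have hYx : ∀ x, ∑ σ, p t σ * Y x σ ≤ S * (θ + (D x + 1 / q) / θ) := fun x =>
      sum_mul_abs_blockObservable_sub_le hr hℓ hc hp0 hp1.le x hθ
        fun u w => swapDefect_block_le hℓ (p t) x u w
    calc ∑ σ, p t σ * |oneBlockAverage K γ β N Ψ J ℓ σ|
        ≤ ∑ σ, p t σ * (1 / N * (q * (S * (4 * L)) + ∑ x, Jm * (Y x σ + S * δ))) :=
          Finset.sum_le_sum fun σ _ => mul_le_mul_of_nonneg_left
            (abs_oneBlockAverage_le hK hγ hN hκ1 hr hc hL hJ σ) (hp0 σ)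
      _ = 1 / N * (q * (S * (4 * L))) +
          1 / N * ∑ x, Jm * (∑ σ, p t σ * Y x σ + S * δ) := by
          have e1 : ∀ x, ∑ σ, p t σ * Y x σ + S * δ = ∑ σ, p t σ * (Y x σ + S * δ) := fun x => by
            simp only [mul_add, Finset.sum_add_distrib, ← Finset.sum_mul, hp1, one_mul]
          have e2 : 1 / (N : ℝ) * (q * (S * (4 * L))) =
              ∑ σ, p t σ * (1 / N * (q * (S * (4 * L)))) := by
            rw [← Finset.sum_mul, hp1, one_mul]
          rw [e2]
          simp only [e1, Finset.mul_sum]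
          rw [Finset.sum_comm, ← Finset.sum_add_distrib]
          refine Finset.sum_congr rfl fun σ _ => ?_
          rw [mul_add, mul_add, Finset.mul_sum, Finset.mul_sum]
          congr 1
          exact Finset.sum_congr rfl fun x _ => by ring
      _ ≤ 1 / N * (q * (S * (4 * L))) +
          1 / N * ∑ x, Jm * (S * (θ + (D x + 1 / q) / θ) + S * δ) := by
          gcongr with x
          exact hYx x
      _ = 1 / N * (q * (S * (4 * L))) + (2 * N + 1) / N * (Jm * S * (θ + 1 / q / θ + δ)) +
          1 / N * (Jm * S / θ * ∑ x, D x) := by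
          have e1 : ∀ x, Jm * (S * (θ + (D x + 1 / q) / θ) + S * δ) =
              Jm * S * (θ + 1 / q / θ + δ) + Jm * S / θ * D x := fun x => by ring
          rw [Finset.sum_congr rfl fun x _ => e1 x, Finset.sum_add_distrib, Finset.sum_const,
            Finset.card_univ, ZMod.card, nsmul_eq_mul, ← Finset.mul_sum]
          push_cast
          ring
      _ ≤ _ := by
          rw [hD, sum_swapDefect_block]
          have e1 : (2 * (N : ℝ) + 1) / N ≤ 3 := by
            rw [div_le_iff₀ (by linarith)]; linarith
          have e2 : 0 ≤ Jm * S * (θ + 1 / q / θ + δ) := by positivity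
          have e3 := mul_le_mul_of_nonneg_right e1 e2
          have e4 : 1 / (N : ℝ) * (Jm * S / θ * (4 * ℓ * ∑ z, swapDefect (p t) z (z + 1))) =
            1 / N * (Jm * S / θ * (4 * ℓ)) * ∑ z, swapDefect (p t) z (z + 1) := by ring
          rw [e4]
          linarith
  have hpc : ∀ σ, Continuous fun t => p t σ := continuous_chainLaw _ ν
  have hc1 : Continuous fun t => ∑ σ, p t σ * |oneBlockAverage K γ β N Ψ J ℓ σ| :=
    continuous_finsetSum _ fun σ _ => (hpc σ).mul continuous_const
  have hc2 : Continuous fun t => ∑ z, swapDefect (p t) z (z + 1) :=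
    continuous_finsetSum _ fun z _ => continuous_finsetSum _ fun σ _ =>
      ((hpc _).sub (hpc σ)).abs
  set a := 1 / (N : ℝ) * (q * (S * (4 * L))) + 3 * Jm * S * (θ + 1 / q / θ + δ) with ha
  set b := 1 / (N : ℝ) * (Jm * S / θ * (4 * ℓ)) with hb
  have hb0 : 0 ≤ b := by positivity
  have hc3 : Continuous fun t => b * ∑ z, swapDefect (p t) z (z + 1) := continuous_const.mul hc2
  calc ∫ t in (0 : ℝ)..T, ∑ σ, p t σ * |oneBlockAverage K γ β N Ψ J ℓ σ|
      ≤ ∫ t in (0 : ℝ)..T, (a + b * ∑ z, swapDefect (p t) z (z + 1)) :=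
        intervalIntegral.integral_mono_on hT (hc1.intervalIntegrable _ _)
          ((continuous_const.add hc3).intervalIntegrable _ _) hpt
    _ = T * a + b * ∫ t in (0 : ℝ)..T, ∑ z, swapDefect (p t) z (z + 1) := by
        rw [intervalIntegral.integral_add (by simp) (hc3.intervalIntegrable _ _),
          intervalIntegral.integral_const_mul b, intervalIntegral.integral_const, smul_eq_mul,
          sub_zero]
    _ ≤ T * a + b * (C₁ * (1 + γ * N)) := by gcongr
    _ = _ := by rw [ha, hb]; ring

end Main

/-! ### The limits -/

theorem ContDiff.exists_bound_and_lipschitz_Icc {J : ℝ → ℝ} (hJ : ContDiff ℝ ∞ J) :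
    ∃ Jm L : ℝ, (∀ a ∈ Set.Icc (-1 : ℝ) 1, |J a| ≤ Jm) ∧
      ∀ a ∈ Set.Icc (-1 : ℝ) 1, ∀ b ∈ Set.Icc (-1 : ℝ) 1, |J a - J b| ≤ L * |a - b| := by
  obtain ⟨Jm, hJm⟩ := isCompact_Icc.exists_bound_of_continuousOn
    (hJ.continuous.continuousOn (s := Set.Icc (-1 : ℝ) 1))
  obtain ⟨L, hL⟩ := (hJ.contDiffOn (s := Set.Icc (-1 : ℝ) 1)).exists_lipschitzOnWith
    (by simp) (convex_Icc _ _) isCompact_Icc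
  exact ⟨Jm, L, hJm, fun a ha b hb => hL.dist_le_mul a ha b hb⟩

/-- The size of the one-block error as a function of `u = γ ℓ + ℓ⁻¹`. -/
noncomputable def blockErrorBound (a b d u : ℝ) : ℝ :=
  a * (Real.exp (b * u) - 1 + u + 3 * √u) + d * √u

theorem tendsto_blockErrorBound (a b d : ℝ) {α : Type*} {l : Filter α} {u : α → ℝ} {u₀ : ℝ}
    (hu : Tendsto u l (𝓝 u₀)) :
    Tendsto (fun x => ENNReal.ofReal (blockErrorBound a b d (u x))) l
      (𝓝 (ENNReal.ofReal (blockErrorBound a b d u₀))) := by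
  have : Continuous (blockErrorBound a b d) := by
    unfold blockErrorBound
    fun_prop
  exact ENNReal.tendsto_ofReal ((this.tendsto u₀).comp hu)

theorem blockErrorBound_zero (a b d : ℝ) : blockErrorBound a b d 0 = 0 := by
  simp [blockErrorBound]

/-- The limiting error with the free parameter set to `√u`, compared with `blockErrorBound`. -/
theorem error_le_blockErrorBound {β γ κ T V C₁ : ℝ} {r ℓ : ℕ} (hγ : 0 < γ) (hℓ : 2 * r + 1 ≤ ℓ)
    (hT : 0 ≤ T) (hκ0 : 0 ≤ κ) (hV : 0 ≤ V) (hC₁0 : 0 ≤ C₁) :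
    T * (3 * V * (√(γ * ℓ + 1 / ℓ) + 1 / (ℓ - r + 1 : ℕ) / √(γ * ℓ + 1 / ℓ) +
        (Real.exp (|β| * (2 * ((2 * ℓ + 1) * (κ * γ)))) - 1 + 1 / (2 * ℓ + 1)))) +
      V / √(γ * ℓ + 1 / ℓ) * (4 * ℓ * (C₁ * γ)) ≤
      blockErrorBound (T * (3 * V)) (6 * |β| * κ) (4 * V * C₁) (γ * ℓ + 1 / ℓ) := by
  have hℓ1 : (1 : ℝ) ≤ ℓ := by
    have : 1 ≤ ℓ := by omega
    exact_mod_cast this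
  set u : ℝ := γ * ℓ + 1 / ℓ with hu
  have hu1 : γ * ℓ ≤ u := by
    have : (0 : ℝ) ≤ 1 / ℓ := by positivity
    linarith
  have hu2 : 1 / (ℓ : ℝ) ≤ u := by
    have : 0 ≤ γ * ℓ := by positivity
    linarith
  have hu0 : 0 < u := by positivity
  have hθ : 0 < √u := Real.sqrt_pos.2 hu0
  clear_value u
  set q : ℕ := ℓ - r + 1 with hq
  set δ : ℝ := Real.exp (|β| * (2 * ((2 * ℓ + 1) * (κ * γ)))) - 1 + 1 / (2 * ℓ + 1) with hδdef
  have hsq : u / √u = √u := Real.div_sqrt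
  have h1 : 1 / (q : ℝ) / √u ≤ 2 * √u := by
    have e1 : (ℓ : ℝ) ≤ 2 * q := by
      have : ℓ ≤ 2 * q := by omega
      exact_mod_cast this
    have e2 : 1 / (q : ℝ) ≤ 2 * (1 / ℓ) := by
      rw [mul_one_div, div_le_div_iff₀ (by positivity) (by positivity)]
      linarith
    calc 1 / (q : ℝ) / √u ≤ 2 * u / √u := by gcongr; linarith
      _ = 2 * √u := by rw [mul_div_assoc, hsq]
  have h2 : δ ≤ Real.exp (6 * |β| * κ * u) - 1 + u := by
    have e1 : |β| * (2 * ((2 * ℓ + 1) * (κ * γ))) ≤ 6 * |β| * κ * u := by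
      calc |β| * (2 * ((2 * ℓ + 1) * (κ * γ))) ≤ |β| * (2 * ((3 * ℓ) * (κ * γ))) := by
            gcongr; linarith
        _ = 6 * |β| * κ * (γ * ℓ) := by ring
        _ ≤ _ := by gcongr
    have e2 : 1 / (2 * (ℓ : ℝ) + 1) ≤ 1 / ℓ := by gcongr; linarith
    have e3 := Real.exp_le_exp.2 e1
    rw [hδdef]
    linarith
  have h3 : V / √u * (4 * ℓ * (C₁ * γ)) ≤ 4 * V * C₁ * √u := by
    calc _ = 4 * V * C₁ * (γ * ℓ / √u) := by ring
      _ ≤ 4 * V * C₁ * (u / √u) := by gcongr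
      _ = _ := by rw [hsq]
  have h4 : T * (3 * V * (√u + 1 / q / √u + δ)) ≤ T * (3 * V) *
      (Real.exp (6 * |β| * κ * u) - 1 + u + 3 * √u) := by
    rw [← mul_assoc]
    refine mul_le_mul_of_nonneg_left ?_ (by positivity)
    linarith
  exact add_le_add h4 h3

/-- The limit `N → ∞` of the one-block error, after choosing the free parameter to be
`√(γ ℓ + ℓ⁻¹)`. -/
theorem exists_limsup_oneBlockError_le {K : ℝ → ℝ} (hK : IsKacProfile K) (β : ℝ)
    {r : ℕ} {Ψ : (ℤ → ℤˣ) → ℝ} (hΨ : DependsOn Ψ (Set.Icc (-(r : ℤ)) r))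
    {J : ℝ → ℝ} (hJ : ContDiff ℝ ∞ J) {T : ℝ} (hT : 0 ≤ T) :
    ∃ a b d : ℝ, ∃ γ₀ > 0, ∀ γ, 0 < γ → γ < γ₀ → ∀ ℓ : ℕ, 2 * r + 1 ≤ ℓ →
      ∀ {Ω : ℕ → Type*} [∀ N, MeasurableSpace (Ω N)] (ν : (N : ℕ) → Measure (Config N))
        (P : (N : ℕ) → Measure (Ω N)) (X : (N : ℕ) → ℝ → Ω N → Config N),
        (∀ N : ℕ, 1 ≤ N → IsMarkovChain ((N : ℝ) ^ 2 • generator K γ β N) (ν N) (P N) (X N)) →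
        limsup (fun N => oneBlockError K γ β N Ψ J T (P N) (X N) ℓ) atTop ≤
          ENNReal.ofReal (blockErrorBound a b d (γ * ℓ + 1 / ℓ)) := by
  obtain ⟨c, hc⟩ := exists_eq_sum_prod_spin (Finset.Icc (-(r : ℤ)) r) Ψ (by simpa using hΨ)
  obtain ⟨Jm, L, hJm, hL⟩ := hJ.exists_bound_and_lipschitz_Icc
  obtain ⟨κ, hκ0, γ₀, hγ₀, hκ⟩ := hK.exists_kacKernel_le
  set S := coeffSize r c with hS
  have hS0 : 0 ≤ S := coeffSize_nonneg r c
  have hJm0 : 0 ≤ Jm := (abs_nonneg _).trans (hJm 0 (by norm_num))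
  set C₁ := 24 * T + 12 * |β| + 8 + 36 * |β| * κ * T with hC₁
  have hC₁0 : 0 ≤ C₁ := by positivity
  refine ⟨T * (3 * (Jm * S)), 6 * |β| * κ, 4 * (Jm * S) * C₁, γ₀, hγ₀,
    fun γ hγ hγ' ℓ hℓ Ω _ ν P X hX => ?_⟩
  set u : ℝ := γ * ℓ + 1 / ℓ with hu
  have hu0 : 0 < u := by
    have : 0 < (ℓ : ℝ) := by exact_mod_cast (by omega : 0 < ℓ)
    positivity
  have hθ : 0 < √u := Real.sqrt_pos.2 hu0
  set q : ℕ := ℓ - r + 1 with hq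
  set δ : ℝ := Real.exp (|β| * (2 * ((2 * ℓ + 1) * (κ * γ)))) - 1 + 1 / (2 * ℓ + 1) with hδ
  set A : ℝ := T * (3 * (Jm * S) * (√u + 1 / q / √u + δ)) with hA
  set B : ℝ := Jm * S / √u * (4 * ℓ * (C₁ * γ)) with hB
  -- the bound of `oneBlockError_le`, rewritten as a constant plus a multiple of `N⁻¹`
  have hbound : ∀ᶠ N : ℕ in atTop, oneBlockError K γ β N Ψ J T (P N) (X N) ℓ ≤
      ENNReal.ofReal ((T * (q * (S * (4 * L))) + Jm * S / √u * (4 * ℓ * C₁)) * (1 / (N : ℝ)) +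
        (A + B)) := by
    filter_upwards [hκ γ hγ hγ', eventually_ge_atTop ℓ, eventually_ge_atTop 1] with N hN hNℓ hN1
    have hN0 : (N : ℝ) ≠ 0 := by positivity
    refine (oneBlockError_le hK hγ.le hN1 hκ0.le hN.1 hN.2 (by omega) hNℓ hc hL hJm hT hθ
      (hX N hN1)).trans (le_of_eq (congrArg _ ?_))
    rw [← hδ, ← hC₁, ← hS, ← hq, hA, hB]
    field_simp
    ring
  have hlim : Tendsto (fun N : ℕ => ENNReal.ofReal
      ((T * (q * (S * (4 * L))) + Jm * S / √u * (4 * ℓ * C₁)) * (1 / (N : ℝ)) + (A + B))) atTop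
      (𝓝 (ENNReal.ofReal (A + B))) := by
    refine ENNReal.tendsto_ofReal ?_
    simpa using (tendsto_one_div_atTop_nhds_zero_nat (𝕜 := ℝ)).const_mul
      (T * (q * (S * (4 * L))) + Jm * S / √u * (4 * ℓ * C₁)) |>.add_const (A + B)
  refine (limsup_le_limsup hbound).trans (hlim.limsup_eq.le.trans (ENNReal.ofReal_le_ofReal ?_))
  exact error_le_blockErrorBound hγ hℓ hT hκ0.le (mul_nonneg hJm0 hS0) hC₁0

theorem mainTheorem4
    (K : ℝ → ℝ) (hK : IsKacProfile K) (β : ℝ)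
    (r : ℕ) (Ψ : (ℤ → ℤˣ) → ℝ) (hΨ : DependsOn Ψ (Set.Icc (-(r : ℤ)) r))
    (J : ℝ → ℝ) (hJ : ContDiff ℝ ∞ J) (T : ℝ) (hT : 0 < T)
    (M : ℝ → ℕ → ℤ) (ν : (γ : ℝ) → (N : ℕ) → Measure (Config N))
    [∀ γ N, IsProbabilityMeasure (ν γ N)] (C : ℝ)
    (hν : ∀ γ ∈ Set.Ioo (0 : ℝ) (1 / 4), ∀ N : ℕ, 1 ≤ N →
      InformationTheory.klDiv (ν γ N) (gibbs β (hamiltonian K γ N) (sector N (M γ N))) ≤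
        ENNReal.ofReal (C * N))
    {Ω : ℝ → ℕ → Type*} [∀ γ N, MeasurableSpace (Ω γ N)] (P : (γ : ℝ) → (N : ℕ) → Measure (Ω γ N))
    (X : (γ : ℝ) → (N : ℕ) → ℝ → Ω γ N → Config N)
    (hX : ∀ γ ∈ Set.Ioo (0 : ℝ) (1 / 4), ∀ N : ℕ, 1 ≤ N →
      IsMarkovChain ((N : ℝ) ^ 2 • generator K γ β N) (ν γ N) (P γ N) (X γ N)) :
    Tendsto (fun ℓ : ℕ => limsup (fun γ : ℝ => limsup (fun N : ℕ =>
        oneBlockError K γ β N Ψ J T (P γ N) (X γ N) ℓ) atTop) (𝓝[>] 0)) atTop (𝓝 0) ∧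
      ∀ ℓ : ℝ → ℕ, Tendsto ℓ (𝓝[>] 0) atTop →
        Tendsto (fun γ : ℝ => γ * ℓ γ) (𝓝[>] 0) (𝓝 0) →
        Tendsto (fun γ : ℝ => limsup (fun N : ℕ =>
          oneBlockError K γ β N Ψ J T (P γ N) (X γ N) (ℓ γ)) atTop) (𝓝[>] 0) (𝓝 0) := by

  obtain ⟨a, b, d, γ₀, hγ₀, hmain⟩ := exists_limsup_oneBlockError_le hK β hΨ hJ hT.le
  have hsmall : ∀ᶠ γ : ℝ in 𝓝[>] 0, γ ∈ Set.Ioo (0 : ℝ) (min γ₀ (1 / 4)) :=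
    Ioo_mem_nhdsGT (by positivity)
  have hbound : ∀ γ ∈ Set.Ioo (0 : ℝ) (min γ₀ (1 / 4)), ∀ ℓ : ℕ, 2 * r + 1 ≤ ℓ →
      limsup (fun N : ℕ => oneBlockError K γ β N Ψ J T (P γ N) (X γ N) ℓ) atTop ≤
        ENNReal.ofReal (blockErrorBound a b d (γ * ℓ + 1 / ℓ)) := fun γ hγ ℓ hℓ =>
    hmain γ hγ.1 (hγ.2.trans_le (min_le_left _ _)) ℓ hℓ (ν γ) (P γ) (X γ)
      fun N hN => hX γ ⟨hγ.1, hγ.2.trans_le (min_le_right _ _)⟩ N hN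
  have hinv : Tendsto (fun ℓ : ℕ => 1 / (ℓ : ℝ)) atTop (𝓝 0) := tendsto_one_div_atTop_nhds_zero_nat
  have hzero : ENNReal.ofReal (blockErrorBound a b d 0) = 0 := by
    rw [blockErrorBound_zero, ENNReal.ofReal_zero]
  constructor
  · have hlim := tendsto_blockErrorBound a b d hinv
    rw [hzero] at hlim
    refine tendsto_of_tendsto_of_tendsto_of_le_of_le' tendsto_const_nhds hlim
      (Eventually.of_forall fun _ => zero_le) ?_
    filter_upwards [eventually_ge_atTop (2 * r + 1)] with ℓ hℓ
    have hid : Tendsto (fun γ : ℝ => γ) (𝓝[>] 0) (𝓝 0) :=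
      tendsto_nhdsWithin_of_tendsto_nhds tendsto_id
    have hu : Tendsto (fun γ : ℝ => γ * ℓ + 1 / (ℓ : ℝ)) (𝓝[>] 0) (𝓝 (1 / ℓ)) := by
      simpa using (hid.mul_const (ℓ : ℝ)).add_const (1 / (ℓ : ℝ))
    refine (limsup_le_limsup ?_).trans (tendsto_blockErrorBound a b d hu).limsup_eq.le
    filter_upwards [hsmall] with γ hγ
    exact hbound γ hγ ℓ hℓ
  · intro ℓ hℓ hγℓ
    have hu : Tendsto (fun γ : ℝ => γ * ℓ γ + 1 / (ℓ γ : ℝ)) (𝓝[>] 0) (𝓝 0) := by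
      simpa using hγℓ.add (hinv.comp hℓ)
    have hlim := tendsto_blockErrorBound a b d hu
    rw [hzero] at hlim
    refine tendsto_of_tendsto_of_tendsto_of_le_of_le' tendsto_const_nhds hlim
      (Eventually.of_forall fun _ => zero_le) ?_
    filter_upwards [hsmall, hℓ.eventually_ge_atTop (2 * r + 1)] with γ hγ hγ'
    exact hbound γ hγ (ℓ γ) hγ'
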